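/- Let $G$ be a (real, finite-dimensional) Lie group with Lie algebra $\mathfrak g$, and let $(\mu,J)$ be a left-invariant almost pseudo-Hermitian structure on $G$: $\mu$ is a pseudo-Riemannian metric of arbitrary signature, $J$ is an almost complex structure ($J^2=-\mathrm{id}$) with $\mu(J\cdot,J\cdot)=\mu(\cdot,\cdot)$, and both are invariant under left translations. Assume that $(\mu,J)$ is nearly pseudo-Kähler, i.e. $(\nabla_XJ)X=0$ for all smooth vector fields $X$ on $G$, where $\nabla$ is the Levi-Civita connection of $\mu$. Equip the tangent bundle $TG$ with its natural Lie group structure, whose multiplication is the differential of the multiplication of $G$ (under the left trivialization $TG\cong G\times\mathfrak g$ it is $(g,X)(h,Y)=(gh,\mathrm{Ad}_{h^{-1}}X+Y)$), and identify $\mathrm{Lie}(TG)=T_{(e,0)}(G\times\mathfrak g)=\mathfrak g\oplus\mathfrak g$, writing $X^c=(X,0)$ and $X^v=(0,X)$ for $X\in\mathfrak g$. Then there is a unique left-invariant almost pseudo-Hermitian structure $(\hat\mu,\hat J)$ on $TG$ such that for all $X,Y\in\mathfrak g$ $$\hat\mu(X^c,Y^v)=\mu(X,Y),\quad \hat\mu(X^c,Y^c)=\hat\mu(X^v,Y^v)=0,\quad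 \hat JX^c=(JX)^c,\quad \hat JX^v=(JX)^v,$$ and $(\hat\mu,\hat J)$ is nearly pseudo-Kähler. Moreover: 1. If $J$ is non-integrable (i.e. does not come from a complex manifold structure on $G$), then so is $\hat J$. Likewise, if the Nijenhuis tensor $N_J(X,Y)=J[JX,Y]+J[X,JY]+[X,Y]-[JX,JY]$ is not identically zero, then neither is $N_{\hat J}$. 2. If $(\mu,J)$ is strictly nearly pseudo-Kähler, then so is $(\hat\mu,\hat J)$. Here "strictly nearly pseudo-Kähler" means nearly pseudo-Kähler but not pseudo-Kähler, and "pseudo-Kähler" means that the almost complex structure $J$ is integrable and the 2-form $\omega=\mu(J\cdot,\cdot)$ is closed. -/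

import Mathlib

open Bundle Manifold VectorField
open scoped ContDiff

noncomputable section

namespace NearlyKahler

set_option linter.unusedSectionVars false

/-! ### Almost pseudo-Hermitian manifolds -/

section Manifold

variable {E : Type*} [NormedAddCommGroup E] [NormedSpace ℝ E]
  {H : Type*} [TopologicalSpace H] (I : ModelWithCorners ℝ E H)
  (M : Type*) [TopologicalSpace M] [ChartedSpace H M] [IsManifold I ∞ M]

/-- An almost pseudo-Hermitian structure on a smooth manifold: a smooth pseudo-Riemannian metric
`metric` (of any signature) together with a smooth almost complex structure `J` which preserves
it. -/
@[ext]
structure AlmostPseudoHermitian where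
  /-- the pseudo-Riemannian metric -/
  metric : ∀ x : M, TangentSpace I x →L[ℝ] TangentSpace I x →L[ℝ] ℝ
  /-- the almost complex structure -/
  J : ∀ x : M, TangentSpace I x →L[ℝ] TangentSpace I x
  contMDiff_metric : ContMDiff I (I.prod 𝓘(ℝ, E →L[ℝ] E →L[ℝ] ℝ)) ∞
    (fun x => TotalSpace.mk' (E →L[ℝ] E →L[ℝ] ℝ)
      (E := fun x : M => TangentSpace I x →L[ℝ] TangentSpace I x →L[ℝ] ℝ) x (metric x))
  contMDiff_J : ContMDiff I (I.prod 𝓘(ℝ, E →L[ℝ] E)) ∞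
    (fun x => TotalSpace.mk' (E →L[ℝ] E)
      (E := fun x : M => TangentSpace I x →L[ℝ] TangentSpace I x) x (J x))
  metric_symm : ∀ (x : M) (v w : TangentSpace I x), metric x v w = metric x w v
  metric_nondegenerate : ∀ (x : M) (v : TangentSpace I x), (∀ w, metric x v w = 0) → v = 0
  J_J : ∀ (x : M) (v : TangentSpace I x), J x (J x v) = -v
  metric_J_J : ∀ (x : M) (v w : TangentSpace I x), metric x (J x v) (J x w) = metric x v w

variable {I M}

/-- A (not necessarily continuous) vector field on `M`. -/
abbrev VecField (I : ModelWithCorners ℝ E H) (M : Type*) [TopologicalSpace M]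
    [ChartedSpace H M] : Type _ :=
  ∀ x : M, TangentSpace I x

/-- The vector field `X` is smooth. -/
def IsSmoothField (X : VecField I M) : Prop :=
  ContMDiff I I.tangent ∞ (fun x => (⟨x, X x⟩ : TangentBundle I M))

/-- The vector field `X` is differentiable at the point `x`. -/
def IsDiffFieldAt (X : VecField I M) (x : M) : Prop :=
  MDifferentiableAt I I.tangent (fun y => (⟨y, X y⟩ : TangentBundle I M)) x

namespace AlmostPseudoHermitian

variable (S : AlmostPseudoHermitian I M)

/-- The vector field `J X`. -/
def applyJ (X : VecField I M) : VecField I M := fun x => S.J x (X x)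

/-- The fundamental form `ω(v, w) = g(J v, w)`. -/
def omega (x : M) (v w : TangentSpace I x) : ℝ := S.metric x (S.J x v) w

/-- `cov` is the Levi-Civita connection of the metric: it is torsion free,
`∇_X Y - ∇_Y X = [X, Y]`, and metric, `v g(Y, Z) = g(∇_v Y, Z) + g(Y, ∇_v Z)`.
Mathlib writes `cov Y x v` for `∇_v Y` at the point `x`. -/
structure IsLeviCivita (cov : CovariantDerivative I E (TangentSpace I : M → Type _)) : Prop where
  torsion_free : ∀ (X Y : VecField I M) (x : M), IsDiffFieldAt X x → IsDiffFieldAt Y x →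
    cov Y x (X x) - cov X x (Y x) = mlieBracket I X Y x
  metric_compatible : ∀ (Y Z : VecField I M) (x : M), IsDiffFieldAt Y x → IsDiffFieldAt Z x →
    ∀ v : TangentSpace I x,
      (mfderiv I 𝓘(ℝ, ℝ) (fun y => S.metric y (Y y) (Z y)) x v : ℝ) =
        S.metric x (cov Y x v) (Z x) + S.metric x (Y x) (cov Z x v)

/-- `(∇_X J) Y = ∇_X (J Y) - J (∇_X Y)` at the point `x`. -/
def covJ (cov : CovariantDerivative I E (TangentSpace I : M → Type _)) (X Y : VecField I M)
    (x : M) : TangentSpace I x :=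
  cov (S.applyJ Y) x (X x) - S.J x (cov Y x (X x))

/-- Nearly pseudo-Kähler: `(∇_X J) X = 0` for all smooth vector fields `X`, where `∇` is the
Levi-Civita connection of the metric. -/
def IsNearlyPseudoKahler : Prop :=
  ∃ cov : CovariantDerivative I E (TangentSpace I : M → Type _), S.IsLeviCivita cov ∧
    ∀ X : VecField I M, IsSmoothField X → ∀ x, S.covJ cov X X x = 0

/-- The Nijenhuis tensor `N_J(X, Y) = J[JX, Y] + J[X, JY] + [X, Y] - [JX, JY]`. -/
def nijenhuis (X Y : VecField I M) (x : M) : TangentSpace I x :=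
  S.J x (mlieBracket I (S.applyJ X) Y x) + S.J x (mlieBracket I X (S.applyJ Y) x)
    + mlieBracket I X Y x - mlieBracket I (S.applyJ X) (S.applyJ Y) x

/-- The Nijenhuis tensor of `J` vanishes identically. -/
def NijenhuisVanishes : Prop :=
  ∀ X Y : VecField I M, IsSmoothField X → IsSmoothField Y → ∀ x, S.nijenhuis X Y x = 0

/-- `J` is integrable, i.e. it comes from a complex manifold structure: around each point there
is a smooth chart `φ` with values in some `ℂⁿ` whose differential satisfies
`dφ (J v) = i dφ (v)`. -/
def IsIntegrable : Prop :=
  ∀ x : M, ∃ (n : ℕ) (φ : OpenPartialHomeomorph M (Fin n → ℂ)), x ∈ φ.source ∧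
    ContMDiffOn I 𝓘(ℝ, Fin n → ℂ) ∞ φ φ.source ∧
    ContMDiffOn 𝓘(ℝ, Fin n → ℂ) I ∞ φ.symm φ.target ∧
    ∀ y ∈ φ.source,
      let dφ : TangentSpace I y →L[ℝ] (Fin n → ℂ) := mfderiv I 𝓘(ℝ, Fin n → ℂ) φ y
      ∀ v : TangentSpace I y, dφ (S.J y v) = Complex.I • dφ v

/-- The derivative at `x` of the function `ω(Y, Z)` in the direction of the vector field `X`. -/
def derivOmega (X Y Z : VecField I M) (x : M) : ℝ :=
  mfderiv I 𝓘(ℝ, ℝ) (fun y => S.omega y (Y y) (Z y)) x (X x)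

/-- The exterior derivative of the fundamental form:
`dω(X,Y,Z) = X ω(Y,Z) + Y ω(Z,X) + Z ω(X,Y) - ω([X,Y],Z) - ω([Y,Z],X) - ω([Z,X],Y)`. -/
def dOmega (X Y Z : VecField I M) (x : M) : ℝ :=
  S.derivOmega X Y Z x + S.derivOmega Y Z X x + S.derivOmega Z X Y x
    - S.omega x (mlieBracket I X Y x) (Z x) - S.omega x (mlieBracket I Y Z x) (X x)
    - S.omega x (mlieBracket I Z X x) (Y x)

/-- Pseudo-Kähler: `J` is integrable and the fundamental form is closed. -/
def IsPseudoKahler : Prop :=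
  S.IsIntegrable ∧ ∀ X Y Z : VecField I M, IsSmoothField X → IsSmoothField Y → IsSmoothField Z →
    ∀ x, S.dOmega X Y Z x = 0

/-- Strictly nearly pseudo-Kähler: nearly pseudo-Kähler, but not pseudo-Kähler. -/
def IsStrictlyNearlyPseudoKahler : Prop :=
  S.IsNearlyPseudoKahler ∧ ¬ S.IsPseudoKahler

end AlmostPseudoHermitian

end Manifold

/-! ### Left invariance -/

/-- Both the metric and the almost complex structure are invariant under the differentials of
all left translations. -/
def AlmostPseudoHermitian.IsLeftInvariant {E : Type*} [NormedAddCommGroup E] [NormedSpace ℝ E]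
    {H : Type*} [TopologicalSpace H] {I : ModelWithCorners ℝ E H}
    {G : Type*} [TopologicalSpace G] [ChartedSpace H G] [Group G] [LieGroup I ∞ G]
    (S : AlmostPseudoHermitian I G) : Prop :=
  (∀ (a x : G) (v w : TangentSpace I x),
    S.metric (a * x) (mfderiv I I (fun y : G => a * y) x v) (mfderiv I I (fun y : G => a * y) x w)
      = S.metric x v w) ∧
  (∀ (a x : G) (v : TangentSpace I x),
    S.J (a * x) (mfderiv I I (fun y : G => a * y) x v)
      = mfderiv I I (fun y : G => a * y) x (S.J x v))

/-! ### The tangent Lie group -/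

section TangentGroup

variable {E : Type*} [NormedAddCommGroup E] [NormedSpace ℝ E]
  {H : Type*} [TopologicalSpace H] {I : ModelWithCorners ℝ E H}
  {G : Type*} [TopologicalSpace G] [ChartedSpace H G] [Group G]

/-- The multiplication of the tangent group, the differential of the multiplication of `G`:
for `A` tangent at `g` and `B` tangent at `h`, the product is `(R_h)_* A + (L_g)_* B`, tangent at
`g h`. In the left trivialization `TG = G × 𝔤` it reads
`(g, X) (h, Y) = (g h, Ad (h⁻¹) X + Y)`. -/
def tangentMul (p q : TangentBundle I G) : TangentBundle I G :=
  ⟨p.1 * q.1,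
    mfderiv I I (fun x : G => x * q.1) p.1 p.2 + mfderiv I I (fun x : G => p.1 * x) q.1 q.2⟩

/-- The inversion of the tangent group, the differential of the inversion of `G`. -/
def tangentInv (p : TangentBundle I G) : TangentBundle I G :=
  tangentMap I I (fun x : G => x⁻¹) p

theorem tangentBundle_mk_eq {x y : G} (h : x = y) {v : TangentSpace I x} {w : TangentSpace I y}
    (hv : (show E from v) = (show E from w)) : (⟨x, v⟩ : TangentBundle I G) = ⟨y, w⟩ := by
  subst h; cases hv; rfl

theorem mfderiv_mfderiv_eq {f g h : G → G} {x : G} (hg : MDifferentiableAt I I g (f x))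
    (hf : MDifferentiableAt I I f x) (he : g ∘ f = h) (v : TangentSpace I x) :
    (mfderiv I I g (f x) (mfderiv I I f x v) : E) = mfderiv I I h x v := by
  subst he
  exact (mfderiv_comp_apply x hg hf v).symm

theorem mfderiv_eq_of_eq_id {h : G → G} {x : G} (he : h = id) (v : TangentSpace I x) :
    (mfderiv I I h x v : E) = v := by
  subst he
  rw [mfderiv_id]; rfl

variable [LieGroup I ∞ G]

theorem mdifferentiableAt_mul_left_const (a x : G) :
    MDifferentiableAt I I (fun y : G => a * y) x :=
  (contMDiff_mul_left (I := I) (n := ∞)).contMDiffAt.mdifferentiableAt (by simp)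

theorem mdifferentiableAt_mul_right_const (a x : G) :
    MDifferentiableAt I I (fun y : G => y * a) x :=
  (contMDiff_mul_right (I := I) (n := ∞)).contMDiffAt.mdifferentiableAt (by simp)

theorem tangentMul_eq (p q : TangentBundle I G) :
    tangentMul p q = tangentMap (I.prod I) I (fun z : G × G => z.1 * z.2)
      ((equivTangentBundleProd I G I G).symm (p, q)) := by
  simp only [tangentMul, tangentMap]
  congr 1
  rw [mfderiv_prod_eq_add_apply ((contMDiff_mul I ∞).mdifferentiable (by simp)).mdifferentiableAt]
  rfl

theorem tangentInv_mul_aux (x : G) (v : TangentSpace I x) :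
    (mfderiv I I (fun z : G => z * x) (x⁻¹) (mfderiv I I (fun z : G => z⁻¹) x v) : E) +
      (mfderiv I I (fun z : G => x⁻¹ * z) x v : E) = 0 := by
  have hi : MDifferentiableAt I I (fun z : G => z⁻¹) x :=
    (contMDiff_inv I ∞).mdifferentiable (by simp) x
  have hm : MDifferentiableAt (I.prod I) I (fun z : G × G => z.1 * z.2) (x⁻¹, x) :=
    (contMDiff_mul I ∞).mdifferentiable (by simp) _
  have hj := hi.prodMk (mdifferentiableAt_id (I := I) (x := x))
  have h1 := mfderiv_comp_apply (I' := I.prod I) (f := fun z : G => (z⁻¹, id z)) x hm hj v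
  have h2 : (fun z : G × G => z.1 * z.2) ∘ (fun z : G => (z⁻¹, id z)) = fun _ => 1 := by
    ext z; simp
  let u : TangentSpace (I.prod I) (x⁻¹, x) :=
    ((mfderiv I I (fun z : G => z⁻¹) x v : E), (v : E))
  have h3 := mfderiv_prod_eq_add_apply (v := u) hm
  rw [h2, mfderiv_const, mfderiv_prodMk hi mdifferentiableAt_id, mfderiv_id] at h1
  exact h3.symm.trans h1.symm

/-- The group structure of the tangent group; the unit is the zero vector at the unit of `G`. -/
instance instGroupTangentBundle : Group (TangentBundle I G) where
  mul := tangentMul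
  one := ⟨1, 0⟩
  inv := tangentInv
  mul_assoc p q r := by
    obtain ⟨x, u⟩ := p
    obtain ⟨y, v⟩ := q
    obtain ⟨z, w⟩ := r
    refine tangentBundle_mk_eq (mul_assoc _ _ _) ?_
    change (mfderiv I I (fun a : G => a * z) (x * y)
        (mfderiv I I (fun a : G => a * y) x u + mfderiv I I (fun a : G => x * a) y v) : E) +
        (mfderiv I I (fun a : G => (x * y) * a) z w : E) =
      (mfderiv I I (fun a : G => a * (y * z)) x u : E) + (mfderiv I I (fun a : G => x * a) (y * z)
        (mfderiv I I (fun a : G => a * z) y v + mfderiv I I (fun a : G => y * a) z w) : E)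
    rw [map_add, map_add]
    have h1 := mfderiv_mfderiv_eq (I := I) (f := fun a => a * y) (g := fun a => a * z)
      (h := fun a => a * (y * z)) (mdifferentiableAt_mul_right_const z (x * y))
      (mdifferentiableAt_mul_right_const y x) (by ext a; simp [mul_assoc]) u
    have h2 := mfderiv_mfderiv_eq (I := I) (f := fun a => x * a) (g := fun a => a * z)
      (h := fun a => x * a * z) (mdifferentiableAt_mul_right_const z (x * y))
      (mdifferentiableAt_mul_left_const x y) (by ext a; simp) v
    have h3 := mfderiv_mfderiv_eq (I := I) (f := fun a => a * z) (g := fun a => x * a)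
      (h := fun a => x * a * z) (mdifferentiableAt_mul_left_const x (y * z))
      (mdifferentiableAt_mul_right_const z y) (by ext a; simp [mul_assoc]) v
    have h4 := mfderiv_mfderiv_eq (I := I) (f := fun a => y * a) (g := fun a => x * a)
      (h := fun a => x * y * a) (mdifferentiableAt_mul_left_const x (y * z))
      (mdifferentiableAt_mul_left_const y z) (by ext a; simp [mul_assoc]) w
    exact (congrArg₂ (fun a b : E => a + b)
      (congrArg₂ (fun a b : E => a + b) h1 (h2.trans h3.symm)) h4.symm).trans
      (add_assoc (G := E) _ _ _)
  one_mul p := by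
    obtain ⟨x, u⟩ := p
    refine tangentBundle_mk_eq (one_mul _) ?_
    change (mfderiv I I (fun a : G => a * x) 1 0 : E) +
      (mfderiv I I (fun a : G => 1 * a) x u : E) = u
    rw [map_zero]
    exact (zero_add (M := E) _).trans (mfderiv_eq_of_eq_id (by ext; simp) u)
  mul_one p := by
    obtain ⟨x, u⟩ := p
    refine tangentBundle_mk_eq (mul_one _) ?_
    change (mfderiv I I (fun a : G => a * 1) x u : E) +
      (mfderiv I I (fun a : G => x * a) 1 0 : E) = u
    rw [map_zero]
    exact (add_zero (M := E) _).trans (mfderiv_eq_of_eq_id (by ext; simp) u)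
  inv_mul_cancel p := by
    obtain ⟨x, u⟩ := p
    exact tangentBundle_mk_eq (inv_mul_cancel _) (tangentInv_mul_aux x u)

/-- The tangent group is a Lie group, for the usual smooth structure of the tangent bundle. -/
instance instLieGroupTangentBundle : LieGroup I.tangent ∞ (TangentBundle I G) where
  contMDiff_mul := by
    have h : (fun p : TangentBundle I G × TangentBundle I G => p.1 * p.2) = fun p =>
        tangentMap (I.prod I) I (fun z : G × G => z.1 * z.2)
          ((equivTangentBundleProd I G I G).symm p) := by
      ext1 p; exact tangentMul_eq p.1 p.2
    rw [h]
    exact ((contMDiff_mul I ∞ (G := G)).contMDiff_tangentMap (m := ∞) (by simp)).comp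
      contMDiff_equivTangentBundleProd_symm
  contMDiff_inv := (contMDiff_inv I ∞ (G := G)).contMDiff_tangentMap (m := ∞) (by simp)

/-- The complete lift `X^c = (X, 0)` of `X ∈ 𝔤` to the Lie algebra of `TG`: the image of `X`
under the differential of the zero section `g ↦ (g, 0)` at the unit. -/
def completeLift (X : GroupLieAlgebra I G) : GroupLieAlgebra I.tangent (TangentBundle I G) :=
  mfderiv I I.tangent (fun g : G => (⟨g, 0⟩ : TangentBundle I G)) 1 X

/-- The vertical lift `X^v = (0, X)` of `X ∈ 𝔤` to the Lie algebra of `TG`: the image of `X`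
under the differential at `0` of the inclusion `w ↦ (1, w)` of the fibre `𝔤` of `TG` over the
unit. (The tangent space `𝔤` is the model space `E` by definition.) -/
def verticalLift (X : GroupLieAlgebra I G) : GroupLieAlgebra I.tangent (TangentBundle I G) :=
  mfderiv 𝓘(ℝ, E) I.tangent (fun w : E => (⟨1, w⟩ : TangentBundle I G)) 0 X

/-- At the unit of `TG`, the structure `T` is obtained from the structure `S` on `G` by
`μ̂(X^c, Y^v) = μ(X, Y)`, `μ̂(X^c, Y^c) = μ̂(X^v, Y^v) = 0`, `Ĵ X^c = (J X)^c` and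
`Ĵ X^v = (J X)^v`. -/
structure IsTangentLift (S : AlmostPseudoHermitian I G)
    (T : AlmostPseudoHermitian I.tangent (TangentBundle I G)) : Prop where
  metric_complete_vertical : ∀ X Y : GroupLieAlgebra I G,
    T.metric 1 (completeLift X) (verticalLift Y) = S.metric 1 X Y
  metric_complete_complete : ∀ X Y : GroupLieAlgebra I G,
    T.metric 1 (completeLift X) (completeLift Y) = 0
  metric_vertical_vertical : ∀ X Y : GroupLieAlgebra I G,
    T.metric 1 (verticalLift X) (verticalLift Y) = 0
  J_complete : ∀ X : GroupLieAlgebra I G, T.J 1 (completeLift X) = completeLift (S.J 1 X)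
  J_vertical : ∀ X : GroupLieAlgebra I G, T.J 1 (verticalLift X) = verticalLift (S.J 1 X)

end TangentGroup

end NearlyKahler

end

open Bundle Manifold VectorField
open scoped ContDiff

noncomputable section

namespace NearlyKahler

set_option linter.unusedSectionVars false

section LeftTrivialization

variable {E : Type*} [NormedAddCommGroup E] [NormedSpace ℝ E]
  {H : Type*} [TopologicalSpace H] {I : ModelWithCorners ℝ E H}
  {G : Type*} [TopologicalSpace G] [ChartedSpace H G] [Group G]

variable (I) in
/-- The differential at `1` of the left translation by `x`. -/
def leftMap (x : G) : E →L[ℝ] E := mfderiv I I (fun y : G => x * y) 1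

variable (I) in
/-- The left Maurer–Cartan form: the differential at `x` of the left translation by `x⁻¹`. -/
def mcForm (x : G) : E →L[ℝ] E := mfderiv I I (fun y : G => x⁻¹ * y) x

variable [LieGroup I ∞ G]

theorem mcForm_eq_of_mul (a x : G) (v : E) :
    mcForm I (a * x) (mfderiv I I (fun y : G => a * y) x v : E) = mcForm I x v := by
  have := mfderiv_mfderiv_eq (I := I) (f := fun y => a * y) (g := fun y => (a * x)⁻¹ * y)
    (h := fun y => x⁻¹ * y) (mdifferentiableAt_mul_left_const (a * x)⁻¹ (a * x))
    (mdifferentiableAt_mul_left_const a x) (by ext y; simp [mul_assoc]) v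
  exact this

theorem mcForm_one (v : E) : mcForm I (1 : G) v = v :=
  mfderiv_eq_of_eq_id (by ext; simp) v

theorem leftMap_one (v : E) : leftMap I (1 : G) v = v :=
  mfderiv_eq_of_eq_id (by ext; simp) v

theorem mcForm_leftMap (x : G) (v : E) : mcForm I x (leftMap I x v) = v := by
  have := mfderiv_mfderiv_eq (I := I) (f := fun y => x * y) (g := fun y => x⁻¹ * y)
    (h := id) (x := (1 : G)) (mdifferentiableAt_mul_left_const x⁻¹ _)
    (mdifferentiableAt_mul_left_const x 1) (by ext y; simp) v
  rw [mfderiv_id] at this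
  have h2 : ∀ y : G, y = x → (mcForm I x : E →L[ℝ] E) =
    (mfderiv I I (fun z : G => x⁻¹ * z) y : E →L[ℝ] E) := by rintro y rfl; rfl
  rw [h2 (x * 1) (mul_one x)]
  exact this

theorem leftMap_mcForm (x : G) (v : E) : leftMap I x (mcForm I x v) = v := by
  have := mfderiv_mfderiv_eq (I := I) (f := fun y => x⁻¹ * y) (g := fun y => x * y)
    (h := id) (x := x) (mdifferentiableAt_mul_left_const x _)
    (mdifferentiableAt_mul_left_const x⁻¹ x) (by ext y; simp) v
  rw [mfderiv_id] at this
  have h2 : ∀ y : G, y = 1 → (leftMap I x : E →L[ℝ] E) =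
    (mfderiv I I (fun z : G => x * z) y : E →L[ℝ] E) := by rintro y rfl; rfl
  rw [h2 (x⁻¹ * x) (inv_mul_cancel x)]
  exact this

theorem mfderiv_mul_left_eq (a x : G) (v : E) :
    (mfderiv I I (fun y : G => a * y) x v : E) = leftMap I (a * x) (mcForm I x v) :=
  (leftMap_mcForm (I := I) (a * x) _).symm.trans
    (congrArg (leftMap I (a * x)) (mcForm_eq_of_mul a x v))

theorem trivializationAt_snd_self (x : G) (v : E) :
    (trivializationAt E (TangentSpace I) x (⟨x, v⟩ : TangentBundle I G)).2 = v :=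
  tangentCoordChange_self (mem_extChartAt_source x)

/-- The left trivialization of the tangent bundle is smooth. -/
theorem contMDiff_mcForm :
    ContMDiff I.tangent 𝓘(ℝ, E) ∞ (fun p : TangentBundle I G => mcForm I p.1 p.2) := by
  have h1 : ContMDiff I.tangent I.tangent ∞
      (fun p : TangentBundle I G => (⟨p.1, 0⟩ : TangentBundle I G)⁻¹ * p) := by
    refine ContMDiff.mul (ContMDiff.inv ?_) contMDiff_id
    exact (contMDiff_zeroSection ℝ (TangentSpace I : G → Type _)).comp
      (contMDiff_proj (TangentSpace I : G → Type _))
  have h2 : (fun p : TangentBundle I G => (⟨p.1, 0⟩ : TangentBundle I G)⁻¹ * p) =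
      fun p => ⟨1, (mcForm I p.1 p.2 : E)⟩ := by
    ext1 p
    refine tangentBundle_mk_eq (inv_mul_cancel _) ?_
    change (mfderiv I I (fun x : G => x * p.1) (p.1⁻¹) (mfderiv I I (fun z : G => z⁻¹) p.1 0) : E)
      + (mfderiv I I (fun x : G => p.1⁻¹ * x) p.1 p.2 : E) = mcForm I p.1 p.2
    rw [map_zero, map_zero]
    exact zero_add (M := E) _
  rw [h2] at h1
  intro p
  have h3 := (contMDiffAt_totalSpace.1 (h1 p)).2
  refine h3.congr_of_eventuallyEq (Filter.Eventually.of_forall fun q => ?_)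
  exact (trivializationAt_snd_self (I := I) (1 : G) _).symm

theorem contMDiff_leftMap :
    ContMDiff (I.prod 𝓘(ℝ, E)) I.tangent ∞
      (fun p : G × E => (⟨p.1, leftMap I p.1 p.2⟩ : TangentBundle I G)) := by
  have h1 : ContMDiff (I.prod 𝓘(ℝ, E)) I.tangent ∞
      (fun p : G × E => (⟨p.1, 0⟩ : TangentBundle I G) * ⟨1, p.2⟩) := by
    refine ContMDiff.mul ?_ ?_
    · exact (contMDiff_zeroSection ℝ (TangentSpace I : G → Type _)).comp contMDiff_fst
    · intro p
      refine contMDiffAt_totalSpace.2 ⟨contMDiffAt_const, contMDiffAt_snd.congr_of_eventuallyEq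
        (Filter.Eventually.of_forall fun q => trivializationAt_snd_self (I := I) (1 : G) _)⟩
  have h2 : (fun p : G × E => (⟨p.1, 0⟩ : TangentBundle I G) * ⟨1, p.2⟩) =
      (fun p : G × E => (⟨p.1, leftMap I p.1 p.2⟩ : TangentBundle I G)) := by
    ext1 p
    refine tangentBundle_mk_eq (mul_one _) ?_
    change (mfderiv I I (fun x : G => x * 1) p.1 0 : E)
      + (mfderiv I I (fun x : G => p.1 * x) 1 p.2 : E) = leftMap I p.1 p.2
    rw [map_zero]
    exact zero_add (M := E) _
  rwa [h2] at h1

/-- The left trivialization of a vector field. -/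
def trivField (X : VecField I G) (x : G) : E := mcForm I x (X x)

variable (I) in
/-- The vector field with a given left trivialization. -/
def ofTriv (f : G → E) : VecField I G := fun x => leftMap I x (f x)

@[simp] theorem trivField_ofTriv (f : G → E) : trivField (ofTriv I f) = f :=
  funext fun x => mcForm_leftMap x (f x)

@[simp] theorem ofTriv_trivField (X : VecField I G) : ofTriv I (trivField X) = X :=
  funext fun x => leftMap_mcForm (E := E) (I := I) x (X x)

theorem IsDiffFieldAt.mdifferentiableAt_trivField {X : VecField I G} {x : G}
    (hX : IsDiffFieldAt X x) : MDifferentiableAt I 𝓘(ℝ, E) (trivField X) x :=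
  MDifferentiableAt.comp x ((contMDiff_mcForm (I := I) (G := G)).mdifferentiable (by simp) _) hX

theorem isDiffFieldAt_ofTriv {f : G → E} {x : G} (hf : MDifferentiableAt I 𝓘(ℝ, E) f x) :
    IsDiffFieldAt (ofTriv I f) x :=
  MDifferentiableAt.comp x (f := fun y : G => (y, f y))
    ((contMDiff_leftMap (I := I) (G := G)).mdifferentiable (by simp) _)
    (mdifferentiableAt_id.prodMk hf)

theorem isSmoothField_ofTriv {f : G → E} (hf : ContMDiff I 𝓘(ℝ, E) ∞ f) :
    IsSmoothField (ofTriv I f) :=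
  contMDiff_leftMap.comp (contMDiff_id.prodMk hf)

theorem IsSmoothField.isDiffFieldAt {X : VecField I G} (hX : IsSmoothField X) (x : G) :
    IsDiffFieldAt X x := ContMDiff.mdifferentiable hX (by simp) x

/-! ### Derivatives along left-invariant vector fields -/

section LeftDeriv

variable {F : Type*} [NormedAddCommGroup F] [NormedSpace ℝ F]
  {F' : Type*} [NormedAddCommGroup F'] [NormedSpace ℝ F']
  {F'' : Type*} [NormedAddCommGroup F''] [NormedSpace ℝ F'']

variable (I) in
/-- The derivative of a vector-valued function along left-invariant vector fields. -/
def leftDeriv (f : G → F) (x : G) : E →L[ℝ] F :=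
  (show E →L[ℝ] F from mfderiv I 𝓘(ℝ, F) f x).comp (leftMap I x)

theorem mfderiv_eq_leftDeriv (f : G → F) (x : G) (v : E) :
    (mfderiv I 𝓘(ℝ, F) f x v : F) = leftDeriv I f x (mcForm I x v) :=
  congrArg (show E →L[ℝ] F from mfderiv I 𝓘(ℝ, F) f x) (leftMap_mcForm (I := I) x v).symm

theorem leftDeriv_const (c : F) (x : G) : leftDeriv I (fun _ : G => c) x = 0 := by
  have h : (mfderiv I 𝓘(ℝ, F) (fun _ : G => c) x : E →L[ℝ] F) = 0 := mfderiv_const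
  rw [leftDeriv, h]; rfl

theorem leftDeriv_add {f g : G → F} {x : G} (hf : MDifferentiableAt I 𝓘(ℝ, F) f x)
    (hg : MDifferentiableAt I 𝓘(ℝ, F) g x) :
    leftDeriv I (f + g) x = leftDeriv I f x + leftDeriv I g x := by
  ext v
  exact DFunLike.congr_fun (mfderiv_add hf hg) (leftMap I x v : TangentSpace I x)

theorem leftDeriv_clm (A : F →L[ℝ] F') {f : G → F} {x : G}
    (hf : MDifferentiableAt I 𝓘(ℝ, F) f x) :
    leftDeriv I (fun y => A (f y)) x = A.comp (leftDeriv I f x) := by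
  have h : (mfderiv I 𝓘(ℝ, F') (fun y => A (f y)) x : E →L[ℝ] F') =
    A.comp (mfderiv I 𝓘(ℝ, F) f x : E →L[ℝ] F) :=
      ((A.hasFDerivAt (x := f x)).hasMFDerivAt.comp x hf.hasMFDerivAt).mfderiv
  rw [leftDeriv, h]; rfl

theorem mdifferentiableAt_clm (A : F →L[ℝ] F') {f : G → F} {x : G}
    (hf : MDifferentiableAt I 𝓘(ℝ, F) f x) :
    MDifferentiableAt I 𝓘(ℝ, F') (fun y => A (f y)) x :=
  (A.hasFDerivAt (x := f x)).hasMFDerivAt.mdifferentiableAt.comp x hf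

theorem leftDeriv_bilin (B : F →L[ℝ] F' →L[ℝ] F'') {f : G → F} {g : G → F'} {x : G}
    (hf : MDifferentiableAt I 𝓘(ℝ, F) f x) (hg : MDifferentiableAt I 𝓘(ℝ, F') g x) (v : E) :
    leftDeriv I (fun y => B (f y) (g y)) x v
      = B (leftDeriv I f x v) (g x) + B (f x) (leftDeriv I g x v) := by
  have h1 := B.isBoundedBilinearMap.hasFDerivAt (f x, g x)
  have h := HasMFDerivAt.comp x (f := fun y => (f y, g y)) h1.hasMFDerivAt
    (hf.prodMk_space hg).hasMFDerivAt
  have h2 : (mfderiv I 𝓘(ℝ, F'') (fun y => B (f y) (g y)) x : E →L[ℝ] F'') =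
    (B.isBoundedBilinearMap.deriv (f x, g x)).comp
      ((mfderiv I 𝓘(ℝ, F × F') (fun y => (f y, g y)) x : E →L[ℝ] F × F')) := h.mfderiv
  have h3 : (mfderiv I 𝓘(ℝ, F × F') (fun y => (f y, g y)) x : E →L[ℝ] F × F') =
     (mfderiv I 𝓘(ℝ, F) f x : E →L[ℝ] F).prod (mfderiv I 𝓘(ℝ, F') g x : E →L[ℝ] F') := by
    have := hf.hasMFDerivAt.2.prodMk hg.hasMFDerivAt.2
    exact HasMFDerivAt.mfderiv ⟨hf.hasMFDerivAt.1.prodMk hg.hasMFDerivAt.1, this⟩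
  rw [leftDeriv, h2, h3]
  exact add_comm _ _

end LeftDeriv

/-! ### The structure equation -/

variable (I G) in
/-- The Lie bracket of the Lie algebra of `G`, seen on the model space. -/
def lieBr (a b : E) : E :=
  mlieBracket I (mulInvariantVectorField (I := I) (G := G) a) (mulInvariantVectorField b) 1

/-- The left trivialization of the bracket of two vector fields. -/
def trivBracket (X Y : VecField I G) (x : G) : E := mcForm I x (mlieBracket I X Y x)

theorem mlieBracket_eq_leftMap (X Y : VecField I G) (x : G) :
    mlieBracket I X Y x = leftMap I x (trivBracket X Y x) :=
  (leftMap_mcForm (E := E) (I := I) x (mlieBracket I X Y x)).symm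

theorem trivBracket_swap (X Y : VecField I G) (x : G) :
    trivBracket X Y x = - trivBracket Y X x :=
  (congrArg (mcForm I x) (mlieBracket_swap_apply (V := X) (W := Y))).trans ((mcForm I x).map_neg _)

variable [FiniteDimensional ℝ E]

scoped instance instMinSmoothness : LieGroup I (minSmoothness ℝ 3) G := by
  simp only [minSmoothness_of_isRCLikeNormedField]; infer_instance

theorem lieBr_add_right (a b c : E) : lieBr I G a (b + c) = lieBr I G a b + lieBr I G a c :=
  haveI := FiniteDimensional.complete ℝ E
  lie_add (L := GroupLieAlgebra I G) (M := GroupLieAlgebra I G) a b c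

theorem lieBr_smul_right (r : ℝ) (a b : E) : lieBr I G a (r • b) = r • lieBr I G a b :=
  haveI := FiniteDimensional.complete ℝ E
  lie_smul (L := GroupLieAlgebra I G) (M := GroupLieAlgebra I G) r a b

theorem lieBr_swap (a b : E) : lieBr I G a b = - lieBr I G b a :=
  haveI := FiniteDimensional.complete ℝ E
  (lie_skew (L := GroupLieAlgebra I G) a b).symm

theorem lieBr_sum_smul_right {ι : Type*} (s : Finset ι) (a : E) (r : ι → ℝ) (b : ι → E) :
    lieBr I G a (∑ i ∈ s, r i • b i) = ∑ i ∈ s, r i • lieBr I G a (b i) := by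
  let A : E →ₗ[ℝ] E := ⟨⟨lieBr I G a, lieBr_add_right a⟩, fun r b => lieBr_smul_right r a b⟩
  have : A (∑ i ∈ s, r i • b i) = ∑ i ∈ s, r i • A (b i) := by simp
  exact this

theorem trivBracket_const (a b : E) (x : G) :
    trivBracket (ofTriv I fun _ : G => a) (ofTriv I fun _ => b) x = lieBr I G a b := by
  have := FiniteDimensional.complete ℝ E
  rw [← mcForm_leftMap (I := I) x (lieBr I G a b)]
  exact congrArg (mcForm I x)
    (congrFun (mulInvariantVector_mlieBracket (I := I) (G := G) a b) x).symm

theorem trivBracket_add_right (V : VecField I G) {f g : G → E} {x : G}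
    (hf : MDifferentiableAt I 𝓘(ℝ, E) f x) (hg : MDifferentiableAt I 𝓘(ℝ, E) g x) :
    trivBracket V (ofTriv I (f + g)) x =
      trivBracket V (ofTriv I f) x + trivBracket V (ofTriv I g) x := by
  have h1 : ofTriv I (f + g) = ofTriv I f + ofTriv I g :=
    funext fun y => (leftMap I y).map_add (f y) (g y)
  rw [h1]
  have := FiniteDimensional.complete ℝ E
  exact (congrArg (mcForm I x) (mlieBracket_add_right (V := V) (isDiffFieldAt_ofTriv hf)
    (isDiffFieldAt_ofTriv hg))).trans ((mcForm I x).map_add _ _)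

theorem trivBracket_smul_const_right (V : VecField I G) {r : G → ℝ} (b : E) {x : G}
    (hr : MDifferentiableAt I 𝓘(ℝ, ℝ) r x) :
    trivBracket V (ofTriv I fun y => r y • b) x =
      leftDeriv I r x (trivField V x) • b + r x • trivBracket V (ofTriv I fun _ => b) x := by
  have h1 : (ofTriv I fun y => r y • b) = r • ofTriv I fun _ => b :=
    funext fun y => (leftMap I y).map_smul (r y) b
  rw [h1]
  have := FiniteDimensional.complete ℝ E
  refine (congrArg (mcForm I x) (mlieBracket_smul_right (V := V) (x := x) hr
    (isDiffFieldAt_ofTriv (f := fun _ => b) mdifferentiableAt_const))).trans ?_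
  refine ((mcForm I x).map_add _ _).trans ?_
  refine congrArg₂ (fun a b : E => a + b) (((mcForm I x).map_smul _ _).trans ?_)
    ((mcForm I x).map_smul _ _)
  refine congrArg₂ (fun (a : ℝ) (b : E) => a • b) ?_ (mcForm_leftMap (E := E) (I := I) x b)
  exact mfderiv_eq_leftDeriv (E := E) (I := I) r x (V x)

theorem trivBracket_sum_right {ι : Type*} (s : Finset ι) (V : VecField I G)
    (r : ι → G → ℝ) (b : ι → E) {x : G} (hr : ∀ i, MDifferentiableAt I 𝓘(ℝ, ℝ) (r i) x) :
    MDifferentiableAt I 𝓘(ℝ, E) (∑ i ∈ s, fun y => r i y • b i) x ∧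
    trivBracket V (ofTriv I (∑ i ∈ s, fun y => r i y • b i)) x =
      ∑ i ∈ s, (leftDeriv I (r i) x (trivField V x) • b i
        + r i x • trivBracket V (ofTriv I fun _ => b i) x) := by
  classical
  induction s using Finset.induction_on with
  | empty =>
    refine ⟨mdifferentiableAt_const, ?_⟩
    have := trivBracket_smul_const_right V (r := fun _ => 0) (0 : E) (x := x)
      mdifferentiableAt_const
    simp only [leftDeriv_const, smul_zero, zero_smul, zero_add] at this
    exact this
  | insert i s hi ih =>
    have hi' : MDifferentiableAt I 𝓘(ℝ, E) (fun y => r i y • b i) x :=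
      (hr i).smul mdifferentiableAt_const
    rw [Finset.sum_insert hi, Finset.sum_insert hi, ← ih.2,
      ← trivBracket_smul_const_right V _ (hr i)]
    exact ⟨hi'.add ih.1, trivBracket_add_right V hi' ih.1⟩

theorem trivBracket_right (V : VecField I G) {f : G → E} {x : G}
    (hf : MDifferentiableAt I 𝓘(ℝ, E) f x) :
    trivBracket V (ofTriv I f) x = leftDeriv I f x (trivField V x) +
      ∑ i, (Module.finBasis ℝ E).repr (f x) i •
        trivBracket V (ofTriv I fun _ => Module.finBasis ℝ E i) x := by
  set b := Module.finBasis ℝ E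
  let c : Fin (Module.finrank ℝ E) → E →L[ℝ] ℝ := fun i =>
    LinearMap.toContinuousLinearMap (b.coord i)
  have hc : ∀ v : E, ∑ i, c i v • b i = v := b.sum_repr
  have h1 := (trivBracket_sum_right Finset.univ V (fun i y => c i (f y)) b
    fun i => mdifferentiableAt_clm (c i) hf).2
  have h2 : (∑ i, fun y => c i (f y) • b i) = f := by
    ext y; rw [Finset.sum_apply]; exact hc (f y)
  rw [h2, Finset.sum_add_distrib] at h1
  rw [h1]
  simp only [leftDeriv_clm _ hf, ContinuousLinearMap.comp_apply, hc]
  rfl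

/-- The structure equation: the bracket of two vector fields in the left trivialization. -/
theorem trivBracket_ofTriv {f g : G → E} {x : G} (hf : MDifferentiableAt I 𝓘(ℝ, E) f x)
    (hg : MDifferentiableAt I 𝓘(ℝ, E) g x) :
    trivBracket (ofTriv I f) (ofTriv I g) x =
      leftDeriv I g x (f x) - leftDeriv I f x (g x) + lieBr I G (f x) (g x) := by
  have key : ∀ w : E, trivBracket (ofTriv I f) (ofTriv I fun _ => w) x =
      - leftDeriv I f x w + lieBr I G (f x) w := by
    intro w
    rw [trivBracket_swap, trivBracket_right _ hf, neg_add, lieBr_swap (f x)]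
    congr 2
    · rw [trivField_ofTriv]
    · conv_rhs => rw [← (Module.finBasis ℝ E).sum_repr (f x)]
      rw [lieBr_sum_smul_right]
      simp only [trivBracket_const]
  rw [trivBracket_right _ hg]
  simp only [key, smul_add, smul_neg, Finset.sum_add_distrib, Finset.sum_neg_distrib]
  rw [← lieBr_sum_smul_right, Module.Basis.sum_repr, trivField_ofTriv]
  simp only [← map_smul, ← map_sum]
  rw [Module.Basis.sum_repr]
  abel

end LeftTrivialization

/-! ### Left-invariant structures -/

section LeftInvariant

variable {E : Type*} [NormedAddCommGroup E] [NormedSpace ℝ E]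
  {H : Type*} [TopologicalSpace H] {I : ModelWithCorners ℝ E H}
  {G : Type*} [TopologicalSpace G] [ChartedSpace H G] [Group G] [LieGroup I ∞ G]

namespace AlmostPseudoHermitian

variable (S : AlmostPseudoHermitian I G)

/-- The metric on the Lie algebra, seen on the model space. -/
def metricOne : E →L[ℝ] E →L[ℝ] ℝ := S.metric 1

/-- The almost complex structure on the Lie algebra, seen on the model space. -/
def JOne : E →L[ℝ] E := S.J 1

theorem JOne_JOne (a : E) : S.JOne (S.JOne a) = -a := S.J_J 1 a

theorem metricOne_symm (a b : E) : S.metricOne a b = S.metricOne b a := S.metric_symm 1 a b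

theorem metricOne_JOne_JOne (a b : E) :
    S.metricOne (S.JOne a) (S.JOne b) = S.metricOne a b := S.metric_J_J 1 a b

theorem metricOne_JOne_left (a b : E) :
    S.metricOne (S.JOne a) b = - S.metricOne a (S.JOne b) := by
  rw [← metricOne_JOne_JOne, JOne_JOne, map_neg, neg_apply]

variable {S}

theorem IsLeftInvariant.metric_eq (hS : S.IsLeftInvariant) (x : G) (v w : E) :
    S.metric x v w = S.metricOne (mcForm I x v) (mcForm I x w) := by
  have h1 : ∀ (y : G) (_ : y = 1) (v w : E), (S.metric y v w : ℝ) = S.metricOne v w := by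
    rintro y rfl v w; rfl
  exact (hS.1 x⁻¹ x v w).symm.trans (h1 (x⁻¹ * x) (inv_mul_cancel x) _ _)

theorem IsLeftInvariant.J_eq (hS : S.IsLeftInvariant) (x : G) (v : E) :
    (S.J x v : E) = leftMap I x (S.JOne (mcForm I x v)) := by
  have h1 : ∀ (y : G) (_ : y = 1) (v : E), (S.J y v : E) = S.JOne v := by
    rintro y rfl v; rfl
  have h2 := (hS.2 x⁻¹ x v).symm.trans (h1 (x⁻¹ * x) (inv_mul_cancel x) _)
  rw [← leftMap_mcForm (E := E) (I := I) x (S.J x v)]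
  exact congrArg (leftMap I x) h2

theorem IsLeftInvariant.applyJ_ofTriv (hS : S.IsLeftInvariant) (f : G → E) :
    S.applyJ (ofTriv I f) = ofTriv I fun x => S.JOne (f x) := by
  ext1 x
  refine (hS.J_eq x _).trans ?_
  exact congrArg (fun z => leftMap I x (S.JOne z)) (mcForm_leftMap x (f x))

variable [FiniteDimensional ℝ E]

variable (S) in
/-- The Nijenhuis tensor on the Lie algebra. -/
def nijenhuisOne (a b : E) : E :=
  S.JOne (lieBr I G (S.JOne a) b) + S.JOne (lieBr I G a (S.JOne b)) + lieBr I G a b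
    - lieBr I G (S.JOne a) (S.JOne b)

theorem IsLeftInvariant.mcForm_J (hS : S.IsLeftInvariant) (x : G) (v : E) :
    mcForm I x (S.J x v) = S.JOne (mcForm I x v) := by
  refine (congrArg (mcForm I x) (hS.J_eq x v)).trans (mcForm_leftMap x _)

theorem IsLeftInvariant.nijenhuis_ofTriv (hS : S.IsLeftInvariant) {f g : G → E} {x : G}
    (hf : MDifferentiableAt I 𝓘(ℝ, E) f x) (hg : MDifferentiableAt I 𝓘(ℝ, E) g x) :
    mcForm I x (S.nijenhuis (ofTriv I f) (ofTriv I g) x) = S.nijenhuisOne (f x) (g x) := by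
  have h1 : mcForm I x (S.nijenhuis (ofTriv I f) (ofTriv I g) x) =
      S.JOne (trivBracket (S.applyJ (ofTriv I f)) (ofTriv I g) x)
      + S.JOne (trivBracket (ofTriv I f) (S.applyJ (ofTriv I g)) x)
      + trivBracket (ofTriv I f) (ofTriv I g) x
      - trivBracket (S.applyJ (ofTriv I f)) (S.applyJ (ofTriv I g)) x := by
    refine ((mcForm I x).map_sub _ _).trans (congrArg₂ (fun a b : E => a - b) ?_ rfl)
    refine ((mcForm I x).map_add _ _).trans (congrArg₂ (fun a b : E => a + b) ?_ rfl)
    refine ((mcForm I x).map_add _ _).trans (congrArg₂ (fun a b : E => a + b) ?_ ?_)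
    · exact hS.mcForm_J x _
    · exact hS.mcForm_J x _
  have hf' := mdifferentiableAt_clm S.JOne hf
  have hg' := mdifferentiableAt_clm S.JOne hg
  rw [h1, hS.applyJ_ofTriv, hS.applyJ_ofTriv, trivBracket_ofTriv hf' hg, trivBracket_ofTriv hf hg',
    trivBracket_ofTriv hf hg, trivBracket_ofTriv hf' hg', leftDeriv_clm _ hf, leftDeriv_clm _ hg]
  simp only [ContinuousLinearMap.comp_apply, map_add, map_sub, JOne_JOne, nijenhuisOne]
  abel

theorem IsLeftInvariant.nijenhuisVanishes_iff (hS : S.IsLeftInvariant) :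
    S.NijenhuisVanishes ↔ ∀ a b, S.nijenhuisOne a b = 0 := by
  constructor
  · intro h a b
    have h1 := h _ _ (isSmoothField_ofTriv (I := I) (f := fun _ : G => a) contMDiff_const)
      (isSmoothField_ofTriv (I := I) (f := fun _ : G => b) contMDiff_const) 1
    have h2 := hS.nijenhuis_ofTriv (f := fun _ : G => a) (g := fun _ => b) (x := 1)
      mdifferentiableAt_const mdifferentiableAt_const
    exact h2.symm.trans ((congrArg (mcForm I 1) h1).trans ((mcForm I (1 : G)).map_zero))
  · intro h X Y hX hY x
    have h2 := hS.nijenhuis_ofTriv (hX.isDiffFieldAt x).mdifferentiableAt_trivField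
      (hY.isDiffFieldAt x).mdifferentiableAt_trivField
    rw [h, ofTriv_trivField, ofTriv_trivField] at h2
    exact (leftMap_mcForm (E := E) (I := I) x _).symm.trans
      ((congrArg (leftMap I x) h2).trans ((leftMap I x).map_zero))

variable (S) in
/-- The fundamental form on the Lie algebra. -/
def omegaOne : E →L[ℝ] E →L[ℝ] ℝ := S.metricOne.comp S.JOne

variable (S) in
/-- The exterior derivative of the fundamental form on the Lie algebra. -/
def dOmegaOne (a b c : E) : ℝ :=
  - (S.omegaOne (lieBr I G a b) c + S.omegaOne (lieBr I G b c) a + S.omegaOne (lieBr I G c a) b)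

theorem omegaOne_swap (a b : E) : S.omegaOne a b = - S.omegaOne b a := by
  change S.metricOne (S.JOne a) b = - S.metricOne (S.JOne b) a
  rw [metricOne_JOne_left, metricOne_symm]

theorem IsLeftInvariant.omega_eq (hS : S.IsLeftInvariant) (x : G) (v w : E) :
    S.omega x v w = S.omegaOne (mcForm I x v) (mcForm I x w) := by
  refine (hS.metric_eq x _ w).trans ?_
  exact congrArg (fun z => S.metricOne z (mcForm I x w)) (hS.mcForm_J x v)

theorem IsLeftInvariant.derivOmega_ofTriv (hS : S.IsLeftInvariant) {f g h : G → E} {x : G}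
    (hg : MDifferentiableAt I 𝓘(ℝ, E) g x) (hh : MDifferentiableAt I 𝓘(ℝ, E) h x) :
    S.derivOmega (ofTriv I f) (ofTriv I g) (ofTriv I h) x =
      S.omegaOne (leftDeriv I g x (f x)) (h x) + S.omegaOne (g x) (leftDeriv I h x (f x)) := by
  rw [← leftDeriv_bilin S.omegaOne hg hh]
  have h1 : (fun y => S.omega y (ofTriv I g y) (ofTriv I h y)) =
      fun y => S.omegaOne (g y) (h y) := by
    ext y
    refine (hS.omega_eq y _ _).trans ?_
    exact congrArg₂ (fun a b => S.omegaOne a b) (mcForm_leftMap y (g y)) (mcForm_leftMap y (h y))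
  unfold derivOmega
  rw [h1]
  rfl

theorem IsLeftInvariant.dOmega_ofTriv (hS : S.IsLeftInvariant) {f g h : G → E} {x : G}
    (hf : MDifferentiableAt I 𝓘(ℝ, E) f x)
    (hg : MDifferentiableAt I 𝓘(ℝ, E) g x) (hh : MDifferentiableAt I 𝓘(ℝ, E) h x) :
    S.dOmega (ofTriv I f) (ofTriv I g) (ofTriv I h) x = S.dOmegaOne (f x) (g x) (h x) := by
  have key : ∀ {u v w : G → E}, S.omega x (mlieBracket I (ofTriv I u) (ofTriv I v) x)
      (ofTriv I w x) = S.omegaOne (trivBracket (ofTriv I u) (ofTriv I v) x) (w x) := by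
    intro u v w
    refine (hS.omega_eq x _ _).trans ?_
    exact congrArg (fun a => S.omegaOne _ a) (mcForm_leftMap x (w x))
  unfold dOmega
  rw [hS.derivOmega_ofTriv hg hh, hS.derivOmega_ofTriv hh hf, hS.derivOmega_ofTriv hf hg,
    key, key, key, trivBracket_ofTriv hf hg, trivBracket_ofTriv hg hh, trivBracket_ofTriv hh hf]
  simp only [map_add, map_sub, add_apply, sub_apply, dOmegaOne]
  rw [omegaOne_swap (f x), omegaOne_swap (g x), omegaOne_swap (h x)]
  ring

theorem IsLeftInvariant.dOmega_eq_zero_iff (hS : S.IsLeftInvariant) :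
    (∀ X Y Z : VecField I G, IsSmoothField X → IsSmoothField Y → IsSmoothField Z →
      ∀ x, S.dOmega X Y Z x = 0) ↔ ∀ a b c, S.dOmegaOne a b c = 0 := by
  have hc : ∀ a : E, IsSmoothField (ofTriv I fun _ : G => a) := fun a =>
    isSmoothField_ofTriv contMDiff_const
  constructor
  · intro h a b c
    rw [← h _ _ _ (hc a) (hc b) (hc c) 1]
    exact (hS.dOmega_ofTriv (f := fun _ => a) (g := fun _ => b) (h := fun _ => c)
      mdifferentiableAt_const mdifferentiableAt_const mdifferentiableAt_const).symm
  · intro h X Y Z hX hY hZ x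
    rw [← ofTriv_trivField X, ← ofTriv_trivField Y, ← ofTriv_trivField Z,
      hS.dOmega_ofTriv (hX.isDiffFieldAt x).mdifferentiableAt_trivField
      (hY.isDiffFieldAt x).mdifferentiableAt_trivField
      (hZ.isDiffFieldAt x).mdifferentiableAt_trivField, h]

/-! ### Left-invariant connections -/

variable (S) in
/-- The bilinear map `Γ` on the Lie algebra defines a left-invariant connection `∇_a b = Γ(a, b)`
which is torsion free and metric and for which `(∇_a J) a = 0`. -/
structure IsNearlyKahlerConnection (Γ : E →L[ℝ] E →L[ℝ] E) : Prop where
  torsion_free : ∀ a b, Γ a b - Γ b a = lieBr I G a b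
  metric_compatible : ∀ a b c, S.metricOne (Γ a b) c + S.metricOne b (Γ a c) = 0
  nearly : ∀ a, Γ a (S.JOne a) = S.JOne (Γ a a)

/-- The value of the left-invariant connection defined by a bilinear map on the Lie algebra. -/
def leftConnectionAt (Γ : E →L[ℝ] E →L[ℝ] E) (Y : VecField I G) (x : G) : E →L[ℝ] E :=
  (leftMap I x).comp ((leftDeriv I (trivField Y) x + Γ.flip (trivField Y x)).comp (mcForm I x))

theorem leftConnectionAt_apply (Γ : E →L[ℝ] E →L[ℝ] E) (Y : VecField I G) (x : G) (v : E) :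
    leftConnectionAt Γ Y x v = leftMap I x (leftDeriv I (trivField Y) x (mcForm I x v)
      + Γ (mcForm I x v) (trivField Y x)) := rfl

variable (I G) in
/-- The left-invariant connection defined by a bilinear map on the Lie algebra. -/
def leftConnection (Γ : E →L[ℝ] E →L[ℝ] E) :
    CovariantDerivative I E (TangentSpace I : G → Type _) where
  toFun Y x := leftConnectionAt (E := E) (I := I) Γ Y x
  isCovariantDerivativeOnUniv := {
    add := by
      intro Y Z x hY hZ _
      have h1 : trivField (Y + Z) = trivField Y + trivField Z :=
        funext fun y => (mcForm I y).map_add (Y y) (Z y)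
      have hY' := IsDiffFieldAt.mdifferentiableAt_trivField (X := Y) hY
      have hZ' := IsDiffFieldAt.mdifferentiableAt_trivField (X := Z) hZ
      suffices h : ∀ v : E, leftConnectionAt Γ (Y + Z) x v =
          leftConnectionAt Γ Y x v + leftConnectionAt Γ Z x v from ContinuousLinearMap.ext h
      intro v
      simp only [leftConnectionAt_apply, h1, leftDeriv_add hY' hZ', add_apply, Pi.add_apply,
        map_add]
      abel
    leibniz := by
      intro Y r x hY hr _
      have h1 : trivField (r • Y) = fun y => r y • trivField Y y :=
        funext fun y => (mcForm I y).map_smul (r y) (Y y)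
      have hY' := IsDiffFieldAt.mdifferentiableAt_trivField (X := Y) hY
      have h3 : ∀ v : E, (mvfderiv I r x v : ℝ) = leftDeriv I r x (mcForm I x v) :=
        fun v => mfderiv_eq_leftDeriv (E := E) (I := I) r x v
      suffices h : ∀ v : E, leftConnectionAt Γ (r • Y) x v = r x • leftConnectionAt Γ Y x v +
          leftDeriv I r x (mcForm I x v) • leftMap I x (trivField Y x) by
        refine ContinuousLinearMap.ext fun v => (h v).trans ?_
        refine congrArg (fun z : E => r x • leftConnectionAt Γ Y x v + z) ?_
        exact congrArg₂ (fun (a : ℝ) (b : E) => a • b) (h3 v).symm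
          (leftMap_mcForm (E := E) (I := I) x (Y x))
      intro v
      have h2 := leftDeriv_bilin (ContinuousLinearMap.lsmul ℝ ℝ) hr hY' (mcForm I x v)
      simp only [ContinuousLinearMap.lsmul_apply] at h2
      rw [leftConnectionAt_apply, leftConnectionAt_apply, h1, h2]
      simp only [map_smul, map_add, smul_add]
      abel }

theorem leftConnection_ofTriv (Γ : E →L[ℝ] E →L[ℝ] E) (f : G → E) (x : G) (v : E) :
    (leftConnection I G Γ (ofTriv I f) x v : E) =
      leftMap I x (leftDeriv I f x (mcForm I x v) + Γ (mcForm I x v) (f x)) := by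
  change leftConnectionAt Γ (ofTriv I f) x v = _
  rw [leftConnectionAt_apply, trivField_ofTriv]

theorem IsLeftInvariant.isNearlyPseudoKahler (hS : S.IsLeftInvariant) {Γ : E →L[ℝ] E →L[ℝ] E}
    (hΓ : S.IsNearlyKahlerConnection Γ) : S.IsNearlyPseudoKahler := by
  have apply_eq : ∀ (f : G → E) (g : G → E) (x : G), (leftConnection I G Γ (ofTriv I f) x
      (ofTriv I g x) : E) = leftMap I x (leftDeriv I f x (g x) + Γ (g x) (f x)) := by
    intro f g x
    refine (leftConnection_ofTriv Γ f x _).trans ?_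
    exact congrArg (fun z => leftMap I x (leftDeriv I f x z + Γ z (f x)))
      (mcForm_leftMap x (g x))
  refine ⟨leftConnection I G Γ, ⟨?_, ?_⟩, ?_⟩
  · intro X Y x hX hY
    obtain ⟨f, rfl⟩ : ∃ f, X = ofTriv I f := ⟨_, (ofTriv_trivField X).symm⟩
    obtain ⟨g, rfl⟩ : ∃ g, Y = ofTriv I g := ⟨_, (ofTriv_trivField Y).symm⟩
    have hf := hX.mdifferentiableAt_trivField
    have hg := hY.mdifferentiableAt_trivField
    rw [trivField_ofTriv] at hf hg
    refine (congrArg₂ (fun a b : E => a - b) (apply_eq g f x) (apply_eq f g x)).trans ?_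
    refine Eq.trans ?_ (mlieBracket_eq_leftMap _ _ x).symm
    rw [trivBracket_ofTriv hf hg, ← map_sub, ← hΓ.torsion_free]
    congr 1
    abel
  · intro Y Z x hY hZ v
    obtain ⟨f, rfl⟩ : ∃ f, Y = ofTriv I f := ⟨_, (ofTriv_trivField Y).symm⟩
    obtain ⟨g, rfl⟩ : ∃ g, Z = ofTriv I g := ⟨_, (ofTriv_trivField Z).symm⟩
    have hf := hY.mdifferentiableAt_trivField
    have hg := hZ.mdifferentiableAt_trivField
    rw [trivField_ofTriv] at hf hg
    have h1 : (fun y => S.metric y (ofTriv I f y) (ofTriv I g y)) =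
        fun y => S.metricOne (f y) (g y) := by
      ext y
      refine (hS.metric_eq y _ _).trans ?_
      exact congrArg₂ (fun a b => S.metricOne a b) (mcForm_leftMap y (f y))
        (mcForm_leftMap y (g y))
    rw [h1]
    refine (mfderiv_eq_leftDeriv (E := E) (I := I) _ x v).trans ?_
    rw [leftDeriv_bilin _ hf hg]
    have h2 : S.metric x (leftConnection I G Γ (ofTriv I f) x v) (ofTriv I g x) =
        S.metricOne (leftDeriv I f x (mcForm I x v) + Γ (mcForm I x v) (f x)) (g x) := by
      refine (hS.metric_eq x _ _).trans (congrArg₂ (fun a b => S.metricOne a b) ?_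
        (mcForm_leftMap x (g x)))
      exact (congrArg (mcForm I x) (leftConnection_ofTriv Γ f x v)).trans (mcForm_leftMap x _)
    have h3 : S.metric x (ofTriv I f x) (leftConnection I G Γ (ofTriv I g) x v) =
        S.metricOne (f x) (leftDeriv I g x (mcForm I x v) + Γ (mcForm I x v) (g x)) := by
      refine (hS.metric_eq x _ _).trans (congrArg₂ (fun a b => S.metricOne a b)
        (mcForm_leftMap x (f x)) ?_)
      exact (congrArg (mcForm I x) (leftConnection_ofTriv Γ g x v)).trans (mcForm_leftMap x _)
    rw [h2, h3]
    have h4 := hΓ.metric_compatible (mcForm I x v) (f x) (g x)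
    simp only [map_add, add_apply]
    refine Eq.trans (b := (S.metricOne (leftDeriv I f x (mcForm I x v)) (g x) +
      S.metricOne (f x) (leftDeriv I g x (mcForm I x v)) : ℝ)) rfl ?_
    refine Eq.trans (b := (S.metricOne (leftDeriv I f x (mcForm I x v)) (g x) +
      S.metricOne (Γ (mcForm I x v) (f x)) (g x) +
      (S.metricOne (f x) (leftDeriv I g x (mcForm I x v)) +
        S.metricOne (f x) (Γ (mcForm I x v) (g x))) : ℝ)) ?_ rfl
    linarith
  · intro X hX x
    obtain ⟨f, rfl⟩ : ∃ f, X = ofTriv I f := ⟨_, (ofTriv_trivField X).symm⟩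
    have hf := (hX.isDiffFieldAt x).mdifferentiableAt_trivField
    rw [trivField_ofTriv] at hf
    unfold covJ
    rw [hS.applyJ_ofTriv]
    have h1 := apply_eq (fun x => S.JOne (f x)) f x
    have h2 := (hS.J_eq x _).trans (congrArg (fun z => leftMap I x (S.JOne z))
      ((congrArg (mcForm I x) (apply_eq f f x)).trans (mcForm_leftMap x _)))
    refine (congrArg₂ (fun a b : E => a - b) h1 h2).trans ?_
    rw [leftDeriv_clm _ hf, hΓ.nearly, map_add S.JOne]
    exact sub_self _

theorem IsLeftInvariant.exists_isNearlyKahlerConnection (hS : S.IsLeftInvariant)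
    (hNK : S.IsNearlyPseudoKahler) : ∃ Γ, S.IsNearlyKahlerConnection Γ := by
  obtain ⟨cov, hLC, hJ⟩ := hNK
  have hd : ∀ a : E, IsDiffFieldAt (ofTriv I fun _ : G => a) 1 := fun a =>
    isDiffFieldAt_ofTriv mdifferentiableAt_const
  let C : E →ₗ[ℝ] E →L[ℝ] E :=
    { toFun := fun b => (cov (ofTriv I fun _ => b) 1 :)
      map_add' := fun a b => by
        have h1 : (ofTriv I fun _ : G => a + b) = (ofTriv I fun _ => a) + ofTriv I fun _ => b :=
          funext fun y => (leftMap I y).map_add a b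
        rw [h1]
        exact cov.isCovariantDerivativeOnUniv.add (hd a) (hd b)
      map_smul' := fun r a => by
        have h1 : (ofTriv I fun _ : G => r • a) = r • (ofTriv I fun _ => a) :=
          funext fun y => (leftMap I y).map_smul r a
        rw [h1]
        exact cov.isCovariantDerivativeOnUniv.smul_const r (hd a) }
  have hC : ∀ a b : E,
      (cov (ofTriv I fun _ => b) 1 (ofTriv I (fun _ : G => a) 1) : E) = C b a := fun a b =>
    congrArg (fun z => C b z) (leftMap_one a)
  refine ⟨(LinearMap.toContinuousLinearMap C).flip, ⟨?_, ?_, ?_⟩⟩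
  · intro a b
    have h := hLC.torsion_free _ _ 1 (hd a) (hd b)
    exact (congrArg₂ (fun a b : E => a - b) (hC a b) (hC b a)).symm.trans h
  · intro a b c
    have h := hLC.metric_compatible _ _ 1 (hd b) (hd c) a
    have h1 : (fun y => S.metric y (ofTriv I (fun _ : G => b) y) (ofTriv I (fun _ => c) y)) =
        fun _ => S.metricOne b c := by
      ext y
      refine (hS.metric_eq y _ _).trans ?_
      exact congrArg₂ (fun a b => S.metricOne a b) (mcForm_leftMap y b) (mcForm_leftMap y c)
    rw [h1] at h
    have h2 : (mfderiv I 𝓘(ℝ, ℝ) (fun _ : G => S.metricOne b c) 1 : E →L[ℝ] ℝ) = 0 :=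
      mfderiv_const
    refine Eq.trans ?_ (h.symm.trans (congrArg (fun A : E →L[ℝ] ℝ => A a) h2))
    exact congrArg₂ (fun u v : ℝ => u + v)
      (congrArg (fun z => S.metricOne (C b a) z) (leftMap_one c).symm)
      (congrArg (fun z => S.metricOne z (C c a)) (leftMap_one b).symm)
  · intro a
    have h := hJ _ (isSmoothField_ofTriv (f := fun _ => a) contMDiff_const) 1
    unfold covJ at h
    rw [hS.applyJ_ofTriv] at h
    have h2 : C (S.JOne a) a - S.JOne (C a a) = 0 :=
      (congrArg₂ (fun a b : E => a - b) (hC a (S.JOne a))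
        (congrArg S.JOne (hC a a))).symm.trans h
    exact sub_eq_zero.1 h2

end AlmostPseudoHermitian

end LeftInvariant

/-! ### Construction of left-invariant structures -/

section Construction

variable {E : Type*} [NormedAddCommGroup E] [NormedSpace ℝ E] [FiniteDimensional ℝ E]
  {H : Type*} [TopologicalSpace H] {I : ModelWithCorners ℝ E H}
  {G : Type*} [TopologicalSpace G] [ChartedSpace H G]

theorem contMDiffAt_clm_of_apply {F : Type*} [NormedAddCommGroup F] [NormedSpace ℝ F]
    {A : G → E →L[ℝ] F} {x : G} (h : ∀ v, ContMDiffAt I 𝓘(ℝ, F) ∞ (fun y => A y v) x) :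
    ContMDiffAt I 𝓘(ℝ, E →L[ℝ] F) ∞ A x := by
  let b := Module.finBasis ℝ E
  let c : Fin (Module.finrank ℝ E) → E →L[ℝ] ℝ := fun i =>
    LinearMap.toContinuousLinearMap (b.coord i)
  have hA : A = fun y => ∑ i, ContinuousLinearMap.smulRightL ℝ E F (c i) (A y (b i)) := by
    ext y v
    conv_lhs => rw [← b.sum_repr v]
    rw [map_sum]
    simp [c]
  rw [hA]
  refine contMDiffAt_finsetSum fun i _ => ?_
  exact (ContinuousLinearMap.contMDiff
    (ContinuousLinearMap.smulRightL ℝ E F (c i))).contMDiffAt.comp x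
    (h (b i))

variable [Group G] [LieGroup I ∞ G]

theorem contMDiffAt_mcForm_symm (x : G) (v : E) :
    ContMDiffAt I 𝓘(ℝ, E) ∞ (fun y : G =>
      mcForm I y ((trivializationAt E (TangentSpace I) x).symm y v)) x := by
  have h1 : ContMDiffAt I I.tangent ∞ (fun y : G =>
      (⟨y, (trivializationAt E (TangentSpace I) x).symm y v⟩ : TangentBundle I G)) x := by
    refine contMDiffAt_totalSpace.2 ⟨contMDiffAt_id, ?_⟩
    refine (contMDiffAt_const (c := v)).congr_of_eventuallyEq ?_
    filter_upwards [(trivializationAt E (TangentSpace I) x).open_baseSet.mem_nhds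
      (mem_baseSet_trivializationAt E (TangentSpace I) x)] with y hy
    rw [(trivializationAt E (TangentSpace I) x).apply_mk_symm hy]
  exact (contMDiff_mcForm (I := I) (G := G)).contMDiffAt.comp x h1

theorem contMDiffAt_trivialization_leftMap (x : G) {f : G → E}
    (hf : ContMDiffAt I 𝓘(ℝ, E) ∞ f x) : ContMDiffAt I 𝓘(ℝ, E) ∞ (fun y : G =>
      (trivializationAt E (TangentSpace I) x (⟨y, leftMap I y (f y)⟩ : TangentBundle I G)).2) x :=
  (contMDiffAt_totalSpace.1 ((contMDiff_leftMap (I := I) (G := G)).contMDiffAt.comp x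
    (contMDiffAt_id.prodMk hf))).2

theorem inCoordinates_tangent_apply {x y : G}
    (hy : y ∈ (trivializationAt E (TangentSpace I) x).baseSet)
    (A : TangentSpace I y →L[ℝ] TangentSpace I y) (v : E) :
    ContinuousLinearMap.inCoordinates E (TangentSpace I) E (TangentSpace I) x y x y A v =
      (trivializationAt E (TangentSpace I) x
        (⟨y, A ((trivializationAt E (TangentSpace I) x).symm y v)⟩ : TangentBundle I G)).2 := by
  rw [ContinuousLinearMap.inCoordinates_eq hy hy]
  simp only [ContinuousLinearMap.comp_apply, ContinuousLinearEquiv.coe_coe]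
  rfl

/-- The left-invariant almost pseudo-Hermitian structure with given values at the unit. -/
def AlmostPseudoHermitian.ofLeftInvariant (B : E →L[ℝ] E →L[ℝ] ℝ) (J : E →L[ℝ] E)
    (hs : ∀ a b, B a b = B b a) (hn : ∀ a, (∀ b, B a b = 0) → a = 0)
    (hJ : ∀ a, J (J a) = -a) (hB : ∀ a b, B (J a) (J b) = B a b) :
    AlmostPseudoHermitian I G where
  metric x := ((B.bilinearComp (mcForm I x) (mcForm I x) : E →L[ℝ] E →L[ℝ] ℝ) :)
  J x := (((leftMap I x).comp (J.comp (mcForm I x)) : E →L[ℝ] E) :)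
  contMDiff_metric := by
    intro x
    rw [contMDiffAt_hom_bundle]
    refine ⟨contMDiffAt_id, ?_⟩
    refine contMDiffAt_clm_of_apply fun v => contMDiffAt_clm_of_apply fun w => ?_
    have h1 : ContMDiffAt I 𝓘(ℝ, ℝ) ∞ (fun y : G =>
      B (mcForm (E := E) I y ((trivializationAt E (TangentSpace I) x).symm y v))
       (mcForm (E := E) I y ((trivializationAt E (TangentSpace I) x).symm y w))) x := by
      have := (contMDiffAt_mcForm_symm (I := I) x v).prodMk_space
        (contMDiffAt_mcForm_symm (I := I) x w)
      exact B.isBoundedBilinearMap.contDiff.contMDiff.contMDiffAt.comp x this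
    refine h1.congr_of_eventuallyEq ?_
    filter_upwards [(trivializationAt E (TangentSpace I) x).open_baseSet.mem_nhds
      (mem_baseSet_trivializationAt E (TangentSpace I) x)] with y hy
    refine (inCoordinates_apply_eq₂ (F₃ := ℝ) (E₃ := Bundle.Trivial G ℝ)
      hy hy (Set.mem_univ _)).trans ?_
    simp
    rfl
  contMDiff_J := by
    intro x
    rw [contMDiffAt_hom_bundle]
    refine ⟨contMDiffAt_id, ?_⟩
    refine contMDiffAt_clm_of_apply fun v => ?_
    have h1 := contMDiffAt_trivialization_leftMap (I := I) x
      ((ContinuousLinearMap.contMDiff (n := ∞) J).contMDiffAt.comp x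
        (contMDiffAt_mcForm_symm (I := I) x v))
    refine h1.congr_of_eventuallyEq ?_
    filter_upwards [(trivializationAt E (TangentSpace I) x).open_baseSet.mem_nhds
      (mem_baseSet_trivializationAt E (TangentSpace I) x)] with y hy
    exact inCoordinates_tangent_apply hy _ v
  metric_symm x v w := hs _ _
  metric_nondegenerate x v h := by
    have h1 : mcForm I x v = 0 := hn _ fun b => by
      have h2 := h (leftMap I x b)
      have h3 : B (mcForm I x v) (mcForm I x (leftMap I x b)) = 0 := h2
      rwa [mcForm_leftMap] at h3
    exact (leftMap_mcForm (E := E) (I := I) x v).symm.trans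
      ((congrArg (leftMap I x) h1).trans (leftMap I x).map_zero)
  J_J x v := by
    change leftMap I x (J (mcForm I x (leftMap I x (J (mcForm I x v))))) = _
    rw [mcForm_leftMap, hJ, map_neg]
    exact congrArg (fun z : E => -z) (leftMap_mcForm (E := E) (I := I) x v)
  metric_J_J x v w := by
    change B (mcForm I x (leftMap I x (J (mcForm I x v))))
      (mcForm I x (leftMap I x (J (mcForm I x w)))) = _
    rw [mcForm_leftMap, mcForm_leftMap, hB]
    rfl

section

variable {B : E →L[ℝ] E →L[ℝ] ℝ} {J : E →L[ℝ] E}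
    (hs : ∀ a b, B a b = B b a) (hn : ∀ a, (∀ b, B a b = 0) → a = 0)
    (hJ : ∀ a, J (J a) = -a) (hB : ∀ a b, B (J a) (J b) = B a b)

theorem AlmostPseudoHermitian.isLeftInvariant_ofLeftInvariant :
    (ofLeftInvariant (I := I) (G := G) B J hs hn hJ hB).IsLeftInvariant := by
  constructor
  · intro a x v w
    exact congrArg₂ (fun v w => B v w) (mcForm_eq_of_mul (E := E) a x v)
      (mcForm_eq_of_mul (E := E) a x w)
  · intro a x v
    have h1 := mcForm_eq_of_mul (E := E) (I := I) a x v
    refine (congrArg (fun z => leftMap I (a * x) (J z)) h1).trans ?_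
    refine Eq.trans ?_ (mfderiv_mul_left_eq (E := E) (I := I) a x _).symm
    exact congrArg (leftMap I (a * x)) (mcForm_leftMap x _).symm

theorem AlmostPseudoHermitian.metricOne_ofLeftInvariant :
    (ofLeftInvariant (I := I) (G := G) B J hs hn hJ hB).metricOne = B := by
  ext v w
  exact congrArg₂ (fun v w => B v w) (mcForm_one (I := I) (G := G) v)
    (mcForm_one (I := I) (G := G) w)

theorem AlmostPseudoHermitian.JOne_ofLeftInvariant :
    (ofLeftInvariant (I := I) (G := G) B J hs hn hJ hB).JOne = J := by
  ext v
  exact (leftMap_one (I := I) (G := G) _).trans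
    (congrArg J (mcForm_one (I := I) (G := G) v))

end

theorem AlmostPseudoHermitian.IsLeftInvariant.ext {S T : AlmostPseudoHermitian I G}
    (hS : S.IsLeftInvariant) (hT : T.IsLeftInvariant) (hm : S.metricOne = T.metricOne)
    (hJ : S.JOne = T.JOne) : S = T := by
  refine AlmostPseudoHermitian.ext ?_ ?_
  · ext1 x
    refine ContinuousLinearMap.ext fun v => ContinuousLinearMap.ext fun w => ?_
    rw [hS.metric_eq x v w, hm]
    exact (hT.metric_eq x v w).symm
  · ext1 x
    refine ContinuousLinearMap.ext fun v => (hS.J_eq x v).trans ?_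
    rw [hJ]
    exact (hT.J_eq x v).symm

end Construction

/-! ### The Lie bracket in the chart at the unit -/

section Chart

variable {E : Type*} [NormedAddCommGroup E] [NormedSpace ℝ E]
  {H : Type*} [TopologicalSpace H] {I : ModelWithCorners ℝ E H} [I.Boundaryless]
  {G : Type*} [TopologicalSpace G] [ChartedSpace H G] [Group G]

variable (I) in
/-- The differential of the chart at the unit. -/
def chartDeriv (x : G) : E →L[ℝ] E := mfderiv I 𝓘(ℝ, E) (extChartAt I (1 : G)) x

variable (I G) in
/-- The differential of the inverse of the chart at the unit. -/
def chartSymmDeriv (z : E) : E →L[ℝ] E := mfderiv 𝓘(ℝ, E) I (extChartAt I (1 : G)).symm z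

variable (I G) in
/-- The left-invariant vector field through `a` in the chart at the unit. -/
def chartField (a z : E) : E :=
  chartDeriv I ((extChartAt I (1 : G)).symm z) (leftMap I ((extChartAt I (1 : G)).symm z) a)

variable (I G) in
/-- The group multiplication in the chart at the unit. -/
def chartMul (z w : E) : E :=
  extChartAt I (1 : G) ((extChartAt I (1 : G)).symm z * (extChartAt I (1 : G)).symm w)

variable [LieGroup I ∞ G]

scoped instance instManifoldOne : IsManifold I 1 G := IsManifold.of_le (n := ∞) (by simp)

theorem chartDeriv_one : chartDeriv I (1 : G) = ContinuousLinearMap.id ℝ E :=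
  mfderiv_extChartAt_self

theorem chartField_one (a : E) : chartField I G a (extChartAt I (1 : G) 1) = a := by
  rw [chartField, extChartAt_to_inv, chartDeriv_one]
  exact leftMap_one a

theorem inverse_chartSymmDeriv {z : E} (hz : z ∈ (extChartAt I (1 : G)).target) :
    (chartSymmDeriv I G z).inverse = chartDeriv I ((extChartAt I (1 : G)).symm z) := by
  have h1 := mfderiv_extChartAt_comp_mfderivWithin_extChartAt_symm hz
  have h2 := mfderivWithin_extChartAt_symm_comp_mfderiv_extChartAt hz
  rw [I.range_eq_univ, mfderivWithin_univ] at h1 h2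
  exact ContinuousLinearMap.inverse_eq h2 h1

theorem lieBr_eq_chart (a b : E) :
    lieBr I G a b = fderiv ℝ (chartField I G b) (extChartAt I (1 : G) 1) a -
      fderiv ℝ (chartField I G a) (extChartAt I (1 : G) 1) b := by
  let V : E → E → E := fun a z =>
    (mfderivWithin 𝓘(ℝ, E) I (extChartAt I (1 : G)).symm (Set.range I) z
        : E →L[ℝ] E).inverse (leftMap I ((extChartAt I (1 : G)).symm z) a)
  have key : ∀ a : E, V a =ᶠ[nhds (extChartAt I (1 : G) 1)] chartField I G a := fun a => by
    filter_upwards [extChartAt_target_mem_nhds (I := I) (1 : G)] with z hz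
    have h1 : (mfderivWithin 𝓘(ℝ, E) I (extChartAt I (1 : G)).symm (Set.range I) z : E →L[ℝ] E)
        = chartSymmDeriv I G z := by rw [I.range_eq_univ, mfderivWithin_univ]; rfl
    rw [chartField, ← inverse_chartSymmDeriv hz, ← h1]
    rfl
  have h1 : lieBr I G a b = (chartDeriv I (1 : G)).inverse (lieBracketWithin ℝ (V a) (V b)
      ((extChartAt I (1 : G)).symm ⁻¹' Set.univ ∩ Set.range I) (extChartAt I (1 : G) 1)) := rfl
  rw [h1, I.range_eq_univ, chartDeriv_one, ContinuousLinearMap.inverse_id, Set.preimage_univ,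
    Set.inter_self, lieBracketWithin_univ,
    Filter.EventuallyEq.lieBracket_vectorField_eq (key a) (key b), lieBracket_eq]
  simp only [chartField_one]
  rfl

theorem mdifferentiableAt_chart {x : G} (hx : x ∈ (extChartAt I (1 : G)).source) :
    MDifferentiableAt I 𝓘(ℝ, E) (extChartAt I (1 : G)) x :=
  mdifferentiableAt_extChartAt (by rwa [extChartAt_source] at hx)

theorem mdifferentiableAt_chart_symm {z : E} (hz : z ∈ (extChartAt I (1 : G)).target) :
    MDifferentiableAt 𝓘(ℝ, E) I (extChartAt I (1 : G)).symm z := by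
  have := mdifferentiableWithinAt_extChartAt_symm hz
  rwa [I.range_eq_univ, mdifferentiableWithinAt_univ] at this

theorem chartSymmDeriv_one : chartSymmDeriv I G (extChartAt I (1 : G) 1) =
    ContinuousLinearMap.id ℝ E := by
  have := mfderivWithin_range_extChartAt_symm (I := I) (x := (1 : G))
  rwa [I.range_eq_univ, mfderivWithin_univ] at this

/-- Differentiating a smooth self-map of `G` in the chart at the unit. -/
theorem fderiv_chart_comp {f : G → G} {z : E} (hz : z ∈ (extChartAt I (1 : G)).target)
    (hf : MDifferentiableAt I I f ((extChartAt I (1 : G)).symm z))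
    (hfz : f ((extChartAt I (1 : G)).symm z) ∈ (extChartAt I (1 : G)).source) (v : E) :
    fderiv ℝ (fun y => extChartAt I (1 : G) (f ((extChartAt I (1 : G)).symm y))) z v =
      chartDeriv I (f ((extChartAt I (1 : G)).symm z))
        (mfderiv I I f ((extChartAt I (1 : G)).symm z) (chartSymmDeriv I G z v) : E) := by
  have h1 := ((mdifferentiableAt_chart hfz).hasMFDerivAt.comp _ hf.hasMFDerivAt).comp z
    (mdifferentiableAt_chart_symm hz).hasMFDerivAt
  have h2 := h1.mfderiv
  rw [mfderiv_eq_fderiv] at h2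
  exact congrArg (fun A : E →L[ℝ] E => A v) h2

theorem chartField_eq_fderiv {z : E} (hz : z ∈ (extChartAt I (1 : G)).target) (a : E) :
    chartField I G a z = fderiv ℝ (chartMul I G z) (extChartAt I (1 : G) 1) a := by
  set x := (extChartAt I (1 : G)).symm z with hx
  have h1 := fderiv_chart_comp (I := I) (f := fun y => x * y) (mem_extChartAt_target (1 : G))
    (mdifferentiableAt_mul_left_const x _) (by
      rw [extChartAt_to_inv, mul_one]; exact (extChartAt I (1 : G)).map_target hz) a
  refine Eq.trans ?_ h1.symm
  rw [chartSymmDeriv_one]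
  have h2 : ∀ y : G, y = 1 → chartField I G a z = chartDeriv I (x * y)
      (mfderiv I I (fun y => x * y) y a : E) := by
    rintro y rfl
    rw [mul_one]; rfl
  exact h2 _ (extChartAt_to_inv _)

theorem contDiffAt_chartMul : ContDiffAt ℝ ∞ (fun p : E × E => chartMul I G p.1 p.2)
    (extChartAt I (1 : G) 1, extChartAt I (1 : G) 1) := by
  rw [← contMDiffAt_iff_contDiffAt]
  have h1 : ContMDiffAt 𝓘(ℝ, E) I ∞ (extChartAt I (1 : G)).symm (extChartAt I (1 : G) 1) :=
    (contMDiffOn_extChartAt_symm (1 : G)).contMDiffAt (extChartAt_target_mem_nhds (1 : G))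
  have h2 : ContMDiffAt I 𝓘(ℝ, E) ∞ (extChartAt I (1 : G)) (((extChartAt I (1 : G)).symm
      (extChartAt I (1 : G) 1)) * ((extChartAt I (1 : G)).symm (extChartAt I (1 : G) 1))) := by
    rw [extChartAt_to_inv, mul_one]
    exact contMDiffAt_extChartAt
  have h3 : ContMDiffAt 𝓘(ℝ, E × E) I ∞ (fun p : E × E => (extChartAt I (1 : G)).symm p.1 *
      (extChartAt I (1 : G)).symm p.2) (extChartAt I (1 : G) 1, extChartAt I (1 : G) 1) :=
    (ContMDiffAt.comp (f := Prod.fst) (extChartAt I (1 : G) 1, extChartAt I (1 : G) 1) h1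
      contDiffAt_fst.contMDiffAt).mul
    (ContMDiffAt.comp (f := Prod.snd) (extChartAt I (1 : G) 1, extChartAt I (1 : G) 1) h1
      contDiffAt_snd.contMDiffAt)
  exact ContMDiffAt.comp (extChartAt I (1 : G) 1, extChartAt I (1 : G) 1) h2 h3

end Chart

/-! ### The Lie algebra of the tangent group -/

section Calculus

variable {E : Type*} [NormedAddCommGroup E] [NormedSpace ℝ E]

/-- The mixed second derivative. -/
def mixedDeriv (M : E × E → E) (e a b : E) : E := fderiv ℝ (fderiv ℝ M) (e, e) (a, 0) (0, b)

theorem mixedDeriv_swap {M : E × E → E} {e : E} (hM : ContDiffAt ℝ 3 M (e, e)) (a b : E) :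
    fderiv ℝ (fderiv ℝ M) (e, e) (0, b) (a, 0) = mixedDeriv M e a b :=
  (hM.isSymmSndFDerivAt (by rw [minSmoothness_of_isRCLikeNormedField]; norm_num)).eq _ _

theorem hasFDerivAt_prodMk_const (e x : E) :
    HasFDerivAt (fun z : E => (z, e)) (ContinuousLinearMap.inl ℝ E E) x := by
  exact (hasFDerivAt_id x).prodMk (hasFDerivAt_const e x)

theorem hasFDerivAt_fderiv_right {M : E × E → E} {e : E} (hM : ContDiffAt ℝ 3 M (e, e)) (A : E) :
    HasFDerivAt (fun x : E => fderiv ℝ M (x, e) (0, A))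
      (((fderiv ℝ (fderiv ℝ M) (e, e)).flip (0, A)).comp (ContinuousLinearMap.inl ℝ E E)) e := by
  have h1 : DifferentiableAt ℝ (fderiv ℝ M) (e, e) :=
    (hM.fderiv_right (m := 2) (by norm_num)).differentiableAt (by simp)
  have h2 := HasFDerivAt.comp (g := fderiv ℝ M) (f := fun z : E => (z, e)) e h1.hasFDerivAt
    (hasFDerivAt_prodMk_const e e)
  have h3 := h2.clm_apply (hasFDerivAt_const ((0 : E), A) e)
  refine h3.congr_fderiv ?_
  ext v
  simp

set_option synthInstance.maxHeartbeats 200000 in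
theorem fderiv_tangent_field {M : E × E → E} {e : E} (hM : ContDiffAt ℝ 3 M (e, e)) {A B : E}
    {F : E × E → E × E}
    (hF : ∀ᶠ z : E × E in nhds (e, 0), F z = (fderiv ℝ M (z.1, e) (0, A),
      fderiv ℝ (fderiv ℝ M) (z.1, e) (0, A) (z.2, 0) + fderiv ℝ M (z.1, e) (0, B))) (a b : E) :
    fderiv ℝ F (e, 0) (a, b) =
      (mixedDeriv M e a A, mixedDeriv M e b A + mixedDeriv M e a B) := by
  have hfst : HasFDerivAt (Prod.fst : E × E → E) (ContinuousLinearMap.fst ℝ E E) (e, (0 : E)) :=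
    hasFDerivAt_fst
  have hsnd : HasFDerivAt (Prod.snd : E × E → E) (ContinuousLinearMap.snd ℝ E E) (e, (0 : E)) :=
    hasFDerivAt_snd
  have h1 : ∀ A : E, HasFDerivAt (fun z : E × E => fderiv ℝ M (z.1, e) (0, A)) _ (e, 0) :=
    fun A => HasFDerivAt.comp (g := fun x : E => fderiv ℝ M (x, e) (0, A)) (e, (0 : E))
      (hasFDerivAt_fderiv_right hM A) hfst
  have h2 : DifferentiableAt ℝ (fderiv ℝ (fderiv ℝ M)) (e, e) :=
    ((hM.fderiv_right (m := 2) (by norm_num)).fderiv_right (m := 1)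
      (by norm_num)).differentiableAt (by simp)
  have hin : HasFDerivAt (fun z : E × E => (z.1, e))
      ((ContinuousLinearMap.fst ℝ E E).prod (0 : E × E →L[ℝ] E)) (e, (0 : E)) :=
    hasFDerivAt_fst.prodMk (hasFDerivAt_const e _)
  have h3 := HasFDerivAt.comp (g := fderiv ℝ (fderiv ℝ M)) (f := fun z : E × E => (z.1, e))
    (e, (0 : E)) h2.hasFDerivAt hin
  have h4 := (h3.clm_apply (hasFDerivAt_const ((0 : E), A) (e, (0 : E)))).clm_apply
    ((ContinuousLinearMap.inl ℝ E E).hasFDerivAt.comp (e, (0 : E)) hsnd)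
  have h5 := (h1 A).prodMk (h4.add (h1 B))
  have h6 : fderiv ℝ F (e, 0) = _ :=
    ((h5.congr_of_eventuallyEq (f₁ := F) hF)).fderiv
  rw [h6, ← mixedDeriv_swap hM b A]
  ext
  · simp [mixedDeriv]
  · simp only [mixedDeriv, ContinuousLinearMap.prod_apply, add_apply, Function.comp_apply,
      ContinuousLinearMap.comp_apply, ContinuousLinearMap.flip_apply, map_zero,
      ContinuousLinearMap.inl_apply, ContinuousLinearMap.coe_snd', ContinuousLinearMap.coe_fst',
      add_zero]

end Calculus

section TangentAlgebra

variable {E : Type*} [NormedAddCommGroup E] [NormedSpace ℝ E]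
  {H : Type*} [TopologicalSpace H] {I : ModelWithCorners ℝ E H} [I.Boundaryless]
  {G : Type*} [TopologicalSpace G] [ChartedSpace H G] [Group G] [LieGroup I ∞ G]

scoped instance instBoundarylessTangent : (I.tangent).Boundaryless := by
  unfold ModelWithCorners.tangent; infer_instance

theorem mem_tangent_chart_source {p : TangentBundle I G} :
    p ∈ (extChartAt I.tangent (1 : TangentBundle I G)).source ↔
      p.1 ∈ (extChartAt I (1 : G)).source := by
  rw [extChartAt_source, extChartAt_source, TangentBundle.mem_chart_source_iff]
  rfl

theorem tangent_chart_apply {g : G} (hg : g ∈ (extChartAt I (1 : G)).source) (u : E) :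
    extChartAt I.tangent (1 : TangentBundle I G) ⟨g, u⟩ =
      (extChartAt I (1 : G) g, chartDeriv I g u) := by
  have hg' : g ∈ (chartAt H (1 : G)).source := by rwa [extChartAt_source] at hg
  have h1 := TangentBundle.continuousLinearMapAt_trivializationAt (I := I) hg'
  have h2 := congrFun ((trivializationAt E (TangentSpace I) (1 : G)).coe_linearMapAt_of_mem (R := ℝ)
    (b := g) hg') u
  refine Prod.ext rfl ?_
  refine h2.symm.trans ?_
  exact congrArg (fun A : E →L[ℝ] E => A u) h1

theorem chartDeriv_chartSymmDeriv {x : E} (hx : x ∈ (extChartAt I (1 : G)).target) (u : E) :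
    chartDeriv I ((extChartAt I (1 : G)).symm x) (chartSymmDeriv I G x u) = u := by
  have h1 := mfderiv_extChartAt_comp_mfderivWithin_extChartAt_symm hx
  rw [I.range_eq_univ, mfderivWithin_univ] at h1
  exact congrArg (fun A : E →L[ℝ] E => A u) h1

theorem tangent_chart_apply_symm {x : E} (hx : x ∈ (extChartAt I (1 : G)).target) (u : E) :
    extChartAt I.tangent (1 : TangentBundle I G)
      ⟨(extChartAt I (1 : G)).symm x, chartSymmDeriv I G x u⟩ = (x, u) := by
  rw [tangent_chart_apply ((extChartAt I (1 : G)).map_target hx), chartDeriv_chartSymmDeriv hx,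
    (extChartAt I (1 : G)).right_inv hx]

theorem tangent_chart_symm_apply {x : E} (hx : x ∈ (extChartAt I (1 : G)).target) (u : E) :
    (extChartAt I.tangent (1 : TangentBundle I G)).symm (x, u) =
      ⟨(extChartAt I (1 : G)).symm x, chartSymmDeriv I G x u⟩ := by
  rw [← tangent_chart_apply_symm hx u]
  exact (extChartAt I.tangent (1 : TangentBundle I G)).left_inv
    (mem_tangent_chart_source.2 ((extChartAt I (1 : G)).map_target hx))

theorem mem_tangent_chart_target {x u : E} (hx : x ∈ (extChartAt I (1 : G)).target) :
    (x, u) ∈ (extChartAt I.tangent (1 : TangentBundle I G)).target := by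
  rw [← tangent_chart_apply_symm hx u]
  exact (extChartAt I.tangent (1 : TangentBundle I G)).map_source
    (mem_tangent_chart_source.2 ((extChartAt I (1 : G)).map_target hx))

theorem tangent_chart_one : extChartAt I.tangent (1 : TangentBundle I G) 1 =
    (extChartAt I (1 : G) 1, 0) :=
  (tangent_chart_apply (mem_extChartAt_source (1 : G)) 0).trans
    (Prod.ext rfl (chartDeriv I (1 : G)).map_zero)

theorem chartMul_tangent {x y : E} (hx : x ∈ (extChartAt I (1 : G)).target)
    (hy : y ∈ (extChartAt I (1 : G)).target)
    (hxy : (extChartAt I (1 : G)).symm x * (extChartAt I (1 : G)).symm y ∈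
      (extChartAt I (1 : G)).source)
    (hM : DifferentiableAt ℝ (fun p : E × E => chartMul I G p.1 p.2) (x, y)) (u v : E) :
    chartMul I.tangent (TangentBundle I G) (x, u) (y, v) =
      (chartMul I G x y, fderiv ℝ (fun p : E × E => chartMul I G p.1 p.2) (x, y) (u, v)) := by
  rw [chartMul, tangent_chart_symm_apply hx, tangent_chart_symm_apply hy]
  refine (tangent_chart_apply hxy _).trans (Prod.ext rfl ?_)
  have h1 := fderiv_chart_comp (I := I) (f := fun a => a * (extChartAt I (1 : G)).symm y) hx
    (mdifferentiableAt_mul_right_const _ _) hxy u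
  have h2 := fderiv_chart_comp (I := I) (f := fun a => (extChartAt I (1 : G)).symm x * a) hy
    (mdifferentiableAt_mul_left_const _ _) hxy v
  refine ((chartDeriv I _).map_add _ _).trans ?_
  refine (congrArg₂ (fun a b : E => a + b) h1.symm h2.symm).trans ?_
  have h3 := HasFDerivAt.comp (f := fun a => (a, y)) x hM.hasFDerivAt
    ((hasFDerivAt_id x).prodMk (hasFDerivAt_const y x))
  have h4 := HasFDerivAt.comp (f := fun a => (x, a)) y hM.hasFDerivAt
    ((hasFDerivAt_const x y).prodMk (hasFDerivAt_id y))
  refine (congrArg₂ (fun A B : E →L[ℝ] E => A u + B v) h3.fderiv h4.fderiv).trans ?_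
  change fderiv ℝ (fun p : E × E => chartMul I G p.1 p.2) (x, y) (u, 0) +
    fderiv ℝ (fun p : E × E => chartMul I G p.1 p.2) (x, y) (0, v) = _
  rw [← map_add]; simp

theorem eventually_chartMul_tangent : ∀ᶠ p : E × E in
    nhds (extChartAt I (1 : G) 1, extChartAt I (1 : G) 1),
    ContDiffAt ℝ 3 (fun p : E × E => chartMul I G p.1 p.2) p ∧ ∀ u v : E,
    chartMul I.tangent (TangentBundle I G) (p.1, u) (p.2, v) =
      (chartMul I G p.1 p.2, fderiv ℝ (fun p : E × E => chartMul I G p.1 p.2) p (u, v)) := by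
  have h0 : ContDiffAt ℝ 3 (fun p : E × E => chartMul I G p.1 p.2)
      (extChartAt I (1 : G) 1, extChartAt I (1 : G) 1) := contDiffAt_chartMul.of_le ENat.LEInfty.out
  have ht := extChartAt_target_mem_nhds (I := I) (1 : G)
  have h3 : ∀ᶠ p : E × E in nhds (extChartAt I (1 : G) 1, extChartAt I (1 : G) 1),
      (extChartAt I (1 : G)).symm p.1 * (extChartAt I (1 : G)).symm p.2 ∈
      (extChartAt I (1 : G)).source := by
    have := topologicalGroup_of_lieGroup I ∞ (G := G)
    have hc : ContinuousAt (extChartAt I (1 : G)).symm (extChartAt I (1 : G) 1) :=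
      continuousAt_extChartAt_symm (1 : G)
    have h4 : ContinuousAt (fun p : E × E => (extChartAt I (1 : G)).symm p.1 *
        (extChartAt I (1 : G)).symm p.2) (extChartAt I (1 : G) 1, extChartAt I (1 : G) 1) :=
      (ContinuousAt.comp (f := Prod.fst) hc continuousAt_fst).mul
        (ContinuousAt.comp (f := Prod.snd) hc continuousAt_snd)
    refine h4 ((isOpen_extChartAt_source (I := I) (1 : G)).mem_nhds ?_)
    simp
  filter_upwards [h0.eventually (by simp), h3, continuousAt_fst.eventually ht,
    continuousAt_snd.eventually ht] with p hp hps hx hy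
  exact ⟨hp, fun u v => chartMul_tangent hx hy hps (hp.differentiableAt (by simp)) u v⟩

theorem eventually_chartField_tangent (A B : E) : ∀ᶠ z : E × E in
    nhds (extChartAt I (1 : G) 1, (0 : E)),
    chartField I.tangent (TangentBundle I G) (A, B) z =
      (fderiv ℝ (fun p : E × E => chartMul I G p.1 p.2) (z.1, extChartAt I (1 : G) 1) (0, A),
       fderiv ℝ (fderiv ℝ (fun p : E × E => chartMul I G p.1 p.2))
        (z.1, extChartAt I (1 : G) 1) (0, A) (z.2, 0) +
       fderiv ℝ (fun p : E × E => chartMul I G p.1 p.2) (z.1, extChartAt I (1 : G) 1) (0, B)) := by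
  set e := extChartAt I (1 : G) 1 with he
  set M := fun p : E × E => chartMul I G p.1 p.2 with hM
  have h1 := (eventually_chartMul_tangent (I := I) (G := G)).curry_nhds
  filter_upwards [(continuousAt_fst (p := (e, (0 : E)))).eventually h1,
    (continuousAt_fst (p := (e, (0 : E)))).eventually
      (extChartAt_target_mem_nhds (I := I) (1 : G))] with z hz hzt
  obtain ⟨x, u⟩ := z
  rw [chartField_eq_fderiv (mem_tangent_chart_target hzt), tangent_chart_one]
  have hC : ContDiffAt ℝ 3 M (x, e) := hz.self_of_nhds.1
  have h2 : chartMul I.tangent (TangentBundle I G) (x, u) =ᶠ[nhds (e, (0 : E))]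
      fun w => (M (x, w.1), fderiv ℝ M (x, w.1) (u, w.2)) := by
    filter_upwards [(continuousAt_fst (p := (e, (0 : E)))).eventually hz] with w hw
    exact hw.2 u w.2
  rw [h2.fderiv_eq]
  have hj : HasFDerivAt (fun w : E × E => (x, w.1))
      ((0 : E × E →L[ℝ] E).prod (ContinuousLinearMap.fst ℝ E E)) (e, (0 : E)) :=
    (hasFDerivAt_const x _).prodMk hasFDerivAt_fst
  have hk : HasFDerivAt (fun w : E × E => (u, w.2))
      ((0 : E × E →L[ℝ] E).prod (ContinuousLinearMap.snd ℝ E E)) (e, (0 : E)) :=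
    (hasFDerivAt_const u _).prodMk hasFDerivAt_snd
  have h3 : HasFDerivAt M (fderiv ℝ M (x, e)) (x, e) :=
    (hC.differentiableAt (by simp)).hasFDerivAt
  have h4 : HasFDerivAt (fderiv ℝ M) (fderiv ℝ (fderiv ℝ M) (x, e)) (x, e) :=
    ((hC.fderiv_right (m := 2) (by norm_num)).differentiableAt (by simp)).hasFDerivAt
  have h5 := (HasFDerivAt.comp (e, (0 : E)) h3 hj).prodMk
    ((HasFDerivAt.comp (e, (0 : E)) h4 hj).clm_apply hk)
  refine (congrArg (fun A' : E × E →L[ℝ] E × E => A' (A, B)) h5.fderiv).trans ?_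
  ext <;> simp [add_comm]

theorem lieBr_tangent (a b a' b' : E) :
    lieBr I.tangent (TangentBundle I G) (a, b) (a', b') =
      (lieBr I G a a', lieBr I G a b' + lieBr I G b a') := by
  have h0 : ContDiffAt ℝ 3 (fun p : E × E => chartMul I G p.1 p.2)
      (extChartAt I (1 : G) 1, extChartAt I (1 : G) 1) := contDiffAt_chartMul.of_le ENat.LEInfty.out
  set M := fun p : E × E => chartMul I G p.1 p.2 with hM
  set e := extChartAt I (1 : G) 1 with he
  have key : ∀ a b, lieBr I G a b = mixedDeriv M e a b - mixedDeriv M e b a := by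
    have h1 : ∀ a b, fderiv ℝ (chartField I G b) e a = mixedDeriv M e a b := by
      intro a b
      have h2 : chartField I G b =ᶠ[nhds e] fun x => fderiv ℝ M (x, e) (0, b) := by
        have h3 := (eventually_chartMul_tangent (I := I) (G := G)).curry_nhds
        filter_upwards [h3, extChartAt_target_mem_nhds (I := I) (1 : G)] with x hx hxt
        rw [chartField_eq_fderiv hxt]
        have h4 := HasFDerivAt.comp (g := M) (f := fun y => (x, y)) e
          (hx.self_of_nhds.1.differentiableAt (by simp)).hasFDerivAt
          ((hasFDerivAt_const x e).prodMk (hasFDerivAt_id e))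
        refine (congrArg (fun A : E →L[ℝ] E => A b) h4.fderiv).trans ?_
        rfl
      rw [h2.fderiv_eq, (hasFDerivAt_fderiv_right h0 b).fderiv]
      rfl
    intro a b
    rw [lieBr_eq_chart, h1, h1]
  rw [lieBr_eq_chart, tangent_chart_one,
    fderiv_tangent_field h0 (eventually_chartField_tangent a' b'),
    fderiv_tangent_field h0 (eventually_chartField_tangent a b), key, key, key]
  ext
  · rfl
  · simp only [Prod.snd_sub]
    abel

end TangentAlgebra

/-! ### Lifts -/

section Lifts

variable {E : Type*} [NormedAddCommGroup E] [NormedSpace ℝ E]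
  {H : Type*} [TopologicalSpace H] {I : ModelWithCorners ℝ E H} [I.Boundaryless]
  {G : Type*} [TopologicalSpace G] [ChartedSpace H G] [Group G] [LieGroup I ∞ G]

variable (I G) in
/-- The zero section of the tangent bundle. -/
def zeroSec (x : G) : TangentBundle I G := ⟨x, 0⟩

theorem contMDiff_zeroSec : ContMDiff I I.tangent ∞ (zeroSec I G) :=
  contMDiff_zeroSection ℝ (TangentSpace I : G → Type _)

theorem contMDiff_fibreOne :
    ContMDiff 𝓘(ℝ, E) I.tangent ∞ (fun w : E => (⟨1, w⟩ : TangentBundle I G)) := fun _ =>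
  contMDiffAt_totalSpace.2 ⟨contMDiffAt_const, contMDiffAt_id.congr_of_eventuallyEq
    (Filter.Eventually.of_forall fun _ => trivializationAt_snd_self (I := I) (1 : G) _)⟩

theorem completeLift_eq (a : E) :
    (completeLift (I := I) (G := G) a : E × E) = (a, 0) := by
  have h1 : MDifferentiableAt I I.tangent (zeroSec I G) 1 :=
    contMDiff_zeroSec.mdifferentiable (by simp) 1
  have h2 : MDifferentiableAt I.tangent 𝓘(ℝ, E × E)
      (extChartAt I.tangent (1 : TangentBundle I G)) (zeroSec I G 1) :=
    mdifferentiableAt_chart (mem_extChartAt_source (1 : TangentBundle I G))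
  have h3 := h2.hasMFDerivAt.comp 1 h1.hasMFDerivAt
  let A : E →L[ℝ] E × E := (ContinuousLinearMap.inl ℝ E E).comp (chartDeriv I (1 : G))
  have h4 : HasMFDerivAt I 𝓘(ℝ, E × E) (fun g : G => (ContinuousLinearMap.inl ℝ E E)
      (extChartAt I (1 : G) g)) 1 A :=
    HasMFDerivAt.comp (1 : G) (g := (ContinuousLinearMap.inl ℝ E E : E → E × E))
      (ContinuousLinearMap.inl ℝ E E).hasMFDerivAt
      (mdifferentiableAt_chart (mem_extChartAt_source (1 : G))).hasMFDerivAt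
  have h5 : extChartAt I.tangent (1 : TangentBundle I G) ∘ zeroSec I G =ᶠ[nhds 1]
      (fun g : G => (ContinuousLinearMap.inl ℝ E E) (extChartAt I (1 : G) g)) := by
    filter_upwards [extChartAt_source_mem_nhds (I := I) (1 : G)] with g hg
    exact (tangent_chart_apply hg 0).trans (Prod.ext rfl (chartDeriv I g).map_zero)
  have h6 := h3.mfderiv.symm.trans (h4.congr_of_eventuallyEq h5).mfderiv
  have h7 := congrArg (fun A : E →L[ℝ] E × E => A a) h6
  have h9 : A a = (a, 0) := by simp only [A, chartDeriv_one]; rfl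
  have h8 : ∀ w : E × E, (mfderiv I.tangent 𝓘(ℝ, E × E)
      (extChartAt I.tangent (1 : TangentBundle I G)) 1 : E × E →L[ℝ] E × E) w = w := fun w =>
    congrArg (fun A : E × E →L[ℝ] E × E => A w)
      (chartDeriv_one (I := I.tangent) (G := TangentBundle I G))
  exact (h8 _).symm.trans (h7.trans h9)

theorem verticalLift_eq (a : E) :
    (verticalLift (I := I) (G := G) a : E × E) = (0, a) := by
  have h1 : MDifferentiableAt 𝓘(ℝ, E) I.tangent (fun w : E => (⟨1, w⟩ : TangentBundle I G)) 0 :=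
    contMDiff_fibreOne.mdifferentiable (by simp) 0
  have h2 : MDifferentiableAt I.tangent 𝓘(ℝ, E × E)
      (extChartAt I.tangent (1 : TangentBundle I G)) (⟨1, (0 : E)⟩ : TangentBundle I G) :=
    mdifferentiableAt_chart (mem_extChartAt_source (1 : TangentBundle I G))
  have h3 := HasMFDerivAt.comp (0 : E) (f := fun w : E => (⟨1, w⟩ : TangentBundle I G))
    h2.hasMFDerivAt h1.hasMFDerivAt
  have h4 : HasMFDerivAt 𝓘(ℝ, E) 𝓘(ℝ, E × E) (fun w : E => (extChartAt I (1 : G) 1, w)) 0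
      (ContinuousLinearMap.inr ℝ E E) :=
    (HasFDerivAt.prodMk (hasFDerivAt_const _ _) (hasFDerivAt_id _)).hasMFDerivAt
  have h5 : extChartAt I.tangent (1 : TangentBundle I G) ∘
      (fun w : E => (⟨1, w⟩ : TangentBundle I G)) = fun w => (extChartAt I (1 : G) 1, w) := by
    ext1 w
    refine (tangent_chart_apply (mem_extChartAt_source (1 : G)) w).trans ?_
    rw [chartDeriv_one]; rfl
  rw [← h5] at h4
  have h6 := h3.mfderiv.symm.trans h4.mfderiv
  have h7 := congrArg (fun A : E →L[ℝ] E × E => A a) h6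
  have h8 : ∀ w : E × E, (mfderiv I.tangent 𝓘(ℝ, E × E)
      (extChartAt I.tangent (1 : TangentBundle I G)) 1 : E × E →L[ℝ] E × E) w = w := fun w =>
    congrArg (fun A : E × E →L[ℝ] E × E => A w)
      (chartDeriv_one (I := I.tangent) (G := TangentBundle I G))
  exact (h8 _).symm.trans h7

variable (I G) in
/-- The differential of the zero section. -/
def zeroSecDeriv (x : G) : E →L[ℝ] E × E := mfderiv I I.tangent (zeroSec I G) x

theorem zeroSec_mul (x y : G) : zeroSec I G (x * y) = zeroSec I G x * zeroSec I G y := by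
  refine (tangentBundle_mk_eq rfl ?_).symm
  change (mfderiv I I (fun z : G => z * y) x 0 : E) + (mfderiv I I (fun z : G => x * z) y 0 : E) = 0
  rw [map_zero, map_zero]
  exact zero_add (M := E) _

theorem zeroSecDeriv_leftMap (x : G) (a : E) :
    zeroSecDeriv I G x (leftMap I x a) =
      leftMap I.tangent (zeroSec I G x) ((a, 0) : E × E) := by
  have h0 : ∀ y, MDifferentiableAt I I.tangent (zeroSec I G) y :=
    contMDiff_zeroSec.mdifferentiable (by simp)
  have h1 := (h0 (x * 1)).hasMFDerivAt.comp (1 : G)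
    (mdifferentiableAt_mul_left_const x (1 : G)).hasMFDerivAt
  have h2 := HasMFDerivAt.comp (1 : G) (f := zeroSec I G)
    (mdifferentiableAt_mul_left_const (I := I.tangent) (zeroSec I G x)
      (zeroSec I G 1)).hasMFDerivAt (h0 1).hasMFDerivAt
  have h3 : zeroSec I G ∘ (fun y : G => x * y) =
      (fun y => zeroSec I G x * y) ∘ zeroSec I G := by
    ext1 y; exact zeroSec_mul x y
  rw [h3] at h1
  have h4 := h1.mfderiv.symm.trans h2.mfderiv
  have h5 := congrArg (fun A : E →L[ℝ] E × E => A a) h4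
  have h6 : ∀ y : G, y = x → zeroSecDeriv I G x (leftMap I x a) =
      zeroSecDeriv I G y (leftMap I x a) := by rintro y rfl; rfl
  refine (h6 (x * 1) (mul_one x)).trans (h5.trans ?_)
  exact congrArg (leftMap I.tangent (zeroSec I G x)) (completeLift_eq a)

theorem zeroSecDeriv_eq (x : G) (v : E) :
    zeroSecDeriv I G x v = leftMap I.tangent (zeroSec I G x) ((mcForm I x v, 0) : E × E) := by
  rw [← zeroSecDeriv_leftMap, leftMap_mcForm]

end Lifts

/-! ### Integrability and immersions -/

theorem exists_openPartialHomeomorph_of_contDiffOn {E F : Type*} [NormedAddCommGroup E]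
    [NormedSpace ℝ E] [CompleteSpace E] [NormedAddCommGroup F] [NormedSpace ℝ F] {g : E → F}
    {O : Set E} (hO : IsOpen O) (hg : ContDiffOn ℝ ∞ g O) {z : E} (hz : z ∈ O) (A : E ≃L[ℝ] F)
    (hA : fderiv ℝ g z = A) :
    ∃ Φ : OpenPartialHomeomorph E F, z ∈ Φ.source ∧ Φ.source ⊆ O ∧ (∀ y, Φ y = g y) ∧
      ContDiffOn ℝ ∞ Φ.symm Φ.target := by
  have hd : ∀ y ∈ O, DifferentiableAt ℝ g y := fun y hy =>
    (hg.contDiffAt (hO.mem_nhds hy)).differentiableAt (by simp)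
  have hz' : HasFDerivAt g (A : E →L[ℝ] F) z := hA ▸ (hd z hz).hasFDerivAt
  have hgz := hg.contDiffAt (hO.mem_nhds hz)
  let Φ := hgz.toOpenPartialHomeomorph g hz' (by simp)
  let V : Set E := O ∩ fderiv ℝ g ⁻¹' Set.range ((↑) : (E ≃L[ℝ] F) → E →L[ℝ] F)
  have hV : IsOpen V := (hg.continuousOn_fderiv_of_isOpen hO (by simp)).isOpen_inter_preimage hO
    ContinuousLinearEquiv.isOpen
  refine ⟨Φ.restrOpen V hV, ?_, ?_, fun y => rfl, ?_⟩
  · exact ⟨hgz.mem_toOpenPartialHomeomorph_source hz' (by simp), hz, A, hA.symm⟩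
  · exact fun y hy => hy.2.1
  · intro w hw
    have hs : (Φ.restrOpen V hV).symm w ∈ V :=
      ((Φ.restrOpen V hV).map_target hw).2
    obtain ⟨hsO, B, hB⟩ := hs
    refine ContDiffAt.contDiffWithinAt (OpenPartialHomeomorph.contDiffAt_symm _ (f₀' := B) hw ?_ ?_)
    · rw [hB]; exact (hd _ hsO).hasFDerivAt
    · exact hg.contDiffAt (hO.mem_nhds hsO)

theorem exists_openPartialHomeomorph_of_contMDiffOn {E : Type*} [NormedAddCommGroup E]
    [NormedSpace ℝ E] [CompleteSpace E] {H : Type*} [TopologicalSpace H]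
    {I : ModelWithCorners ℝ E H} [I.Boundaryless] {M : Type*} [TopologicalSpace M]
    [ChartedSpace H M] [IsManifold I ∞ M] [IsManifold I 1 M] {F : Type*} [NormedAddCommGroup F]
    [NormedSpace ℝ F] {f : M → F} {U : Set M} (hU : IsOpen U) (hf : ContMDiffOn I 𝓘(ℝ, F) ∞ f U)
    {x : M} (hx : x ∈ U) (A : E ≃L[ℝ] F) (hA : HasMFDerivAt I 𝓘(ℝ, F) f x (A : E →L[ℝ] F)) :
    ∃ φ : OpenPartialHomeomorph M F, x ∈ φ.source ∧ φ.source ⊆ U ∧ (∀ y ∈ φ.source, φ y = f y) ∧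
      ContMDiffOn 𝓘(ℝ, F) I ∞ φ.symm φ.target := by
  let c : OpenPartialHomeomorph M E := (chartAt H x).transHomeomorph I.toHomeomorph
  have hcs : c.source = (extChartAt I x).source := (extChartAt_source I x).symm
  have hct : c.target = (extChartAt I x).target := by
    rw [extChartAt_target, I.range_eq_univ, Set.inter_univ]; rfl
  have hc2 : ContMDiffOn 𝓘(ℝ, E) I ∞ c.symm c.target := by
    rw [hct]; exact contMDiffOn_extChartAt_symm x
  have hxc : x ∈ c.source := mem_chart_source H x
  let O : Set E := c.target ∩ c.symm ⁻¹' U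
  have hO : IsOpen O := c.isOpen_inter_preimage_symm hU
  have hg : ContDiffOn ℝ ∞ (f ∘ c.symm) O :=
    (hf.comp (hc2.mono Set.inter_subset_left) fun y hy => hy.2).contDiffOn
  have hcx : c x ∈ O := ⟨c.map_source hxc, by rw [Set.mem_preimage, c.left_inv hxc]; exact hx⟩
  have hder : fderiv ℝ (f ∘ c.symm) (c x) = A := by
    have h1 : HasMFDerivAt I 𝓘(ℝ, E) c x (ContinuousLinearMap.id ℝ E) :=
      ((mdifferentiableAt_extChartAt (mem_chart_source H x)).hasMFDerivAt).congr_mfderiv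
        mfderiv_extChartAt_self
    have h2 : HasFDerivAt (f ∘ c.symm) (fderiv ℝ (f ∘ c.symm) (c x)) (c x) :=
      ((hg.contDiffAt (hO.mem_nhds hcx)).differentiableAt (by simp)).hasFDerivAt
    have h3 := (h2.hasMFDerivAt.comp x h1).congr_of_eventuallyEq (f₁ := f) (by
      filter_upwards [c.open_source.mem_nhds hxc] with y hy
      simp [c.left_inv hy])
    exact h3.mfderiv.symm.trans hA.mfderiv
  obtain ⟨Φ, h1, h2, h3, h4⟩ := exists_openPartialHomeomorph_of_contDiffOn hO hg hcx A hder
  refine ⟨c.trans Φ, ?_, ?_, ?_, ?_⟩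
  · exact ⟨hxc, h1⟩
  · intro y hy
    have := (h2 hy.2).2
    have h5 : c.symm (c y) ∈ U := this
    rwa [c.left_inv hy.1] at h5
  · intro y hy
    refine (h3 (c y)).trans ?_
    rw [Function.comp_apply, c.left_inv hy.1]
  · exact hc2.comp (h4.contMDiffOn.mono fun y hy => hy.1) fun y hy => hy.2

theorem exists_complex_projection {E : Type*} [NormedAddCommGroup E] [NormedSpace ℝ E] {m : ℕ}
    (D : E →L[ℝ] (Fin m → ℂ)) (hD : Function.Injective D) (K : E → E)
    (hK : ∀ v, D (K v) = Complex.I • D v) :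
    ∃ (k : ℕ) (Q : (Fin m → ℂ) →L[ℂ] (Fin k → ℂ)), Function.Bijective fun v => Q (D v) := by
  let W : Submodule ℂ (Fin m → ℂ) :=
    { carrier := Set.range D
      add_mem' := by rintro _ _ ⟨a, rfl⟩ ⟨b, rfl⟩; exact ⟨a + b, map_add _ _ _⟩
      zero_mem' := ⟨0, map_zero _⟩
      smul_mem' := by
        rintro c _ ⟨a, rfl⟩
        refine ⟨c.re • a + c.im • K a, ?_⟩
        rw [map_add, map_smul, map_smul, hK]
        ext i
        simp only [Pi.add_apply, Pi.smul_apply, smul_eq_mul, Complex.real_smul]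
        nth_rewrite 3 [← Complex.re_add_im c]
        ring }
  obtain ⟨P, hP⟩ := LinearMap.exists_leftInverse_of_injective W.subtype (by simp)
  let e := (Module.finBasis ℂ W).equivFun
  refine ⟨Module.finrank ℂ W, LinearMap.toContinuousLinearMap (e.toLinearMap ∘ₗ P), ?_⟩
  have hQ : ∀ v, LinearMap.toContinuousLinearMap (e.toLinearMap ∘ₗ P) (D v) =
      e ⟨D v, v, rfl⟩ := fun v => congrArg e (LinearMap.congr_fun hP ⟨D v, v, rfl⟩)
  constructor
  · intro a b hab
    simp only [hQ] at hab
    exact hD (congrArg Subtype.val (e.injective hab))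
  · intro w
    obtain ⟨⟨_, v, rfl⟩, hv⟩ := e.surjective w
    exact ⟨v, (hQ v).trans hv⟩

theorem AlmostPseudoHermitian.exists_chart_of_immersion {E : Type*} [NormedAddCommGroup E]
    [NormedSpace ℝ E] [FiniteDimensional ℝ E] {H : Type*} [TopologicalSpace H]
    {I : ModelWithCorners ℝ E H} [I.Boundaryless] {M : Type*} [TopologicalSpace M]
    [ChartedSpace H M] [IsManifold I ∞ M] [IsManifold I 1 M] (S : AlmostPseudoHermitian I M)
    {m : ℕ} {f : M → Fin m → ℂ} {U : Set M} (hU : IsOpen U)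
    (hf : ContMDiffOn I 𝓘(ℝ, Fin m → ℂ) ∞ f U) (f' : M → E →L[ℝ] (Fin m → ℂ))
    (hf' : ∀ y ∈ U, HasMFDerivAt I 𝓘(ℝ, Fin m → ℂ) f y (f' y))
    (hJ : ∀ y ∈ U, ∀ v : E, f' y (S.J y v : E) = Complex.I • f' y v) {x : M} (hx : x ∈ U)
    (hinj : Function.Injective (f' x)) :
    ∃ (n : ℕ) (φ : OpenPartialHomeomorph M (Fin n → ℂ)), x ∈ φ.source ∧
      ContMDiffOn I 𝓘(ℝ, Fin n → ℂ) ∞ φ φ.source ∧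
      ContMDiffOn 𝓘(ℝ, Fin n → ℂ) I ∞ φ.symm φ.target ∧
      ∀ y ∈ φ.source,
        let dφ : TangentSpace I y →L[ℝ] (Fin n → ℂ) := mfderiv I 𝓘(ℝ, Fin n → ℂ) φ y
        ∀ v : TangentSpace I y, dφ (S.J y v) = Complex.I • dφ v := by
  obtain ⟨k, Q, hQ⟩ := exists_complex_projection (f' x) hinj (S.J x) (hJ x hx)
  let R : (Fin m → ℂ) →L[ℝ] (Fin k → ℂ) := Q.restrictScalars ℝ
  have hR : ContMDiff 𝓘(ℝ, Fin m → ℂ) 𝓘(ℝ, Fin k → ℂ) ∞ R := R.contMDiff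
  let A : E ≃L[ℝ] (Fin k → ℂ) := ContinuousLinearEquiv.ofBijective (R.comp (f' x))
    (LinearMap.ker_eq_bot.2 hQ.1) (LinearMap.range_eq_top.2 hQ.2)
  have hRf : ∀ y ∈ U, HasMFDerivAt I 𝓘(ℝ, Fin k → ℂ) (fun z => R (f z)) y (R.comp (f' y)) :=
    fun y hy => HasMFDerivAt.comp y (g := R) R.hasMFDerivAt (hf' y hy)
  have hsm : ContMDiffOn I 𝓘(ℝ, Fin k → ℂ) ∞ (fun z => R (f z)) U := hR.comp_contMDiffOn hf
  obtain ⟨φ, h1, h2, h3, h4⟩ := exists_openPartialHomeomorph_of_contMDiffOn hU hsm hx A (by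
    refine (hRf x hx).congr_mfderiv ?_
    ext v; rfl)
  refine ⟨k, φ, h1, (hsm.mono h2).congr h3, h4, fun y hy => ?_⟩
  intro dφ v
  have h5 : dφ = R.comp (f' y) := ((hRf y (h2 hy)).congr_of_eventuallyEq (by
    filter_upwards [φ.open_source.mem_nhds hy] with z hz using h3 z hz)).mfderiv
  rw [h5]
  refine (congrArg R (hJ y (h2 hy) v)).trans ?_
  exact Q.map_smul Complex.I (f' y v)

section TangentGroup

variable {E : Type*} [NormedAddCommGroup E] [NormedSpace ℝ E] [FiniteDimensional ℝ E]
  {H : Type*} [TopologicalSpace H] {I : ModelWithCorners ℝ E H} [I.Boundaryless]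
  {G : Type*} [TopologicalSpace G] [ChartedSpace H G] [Group G] [LieGroup I ∞ G]

theorem AlmostPseudoHermitian.IsIntegrable.of_tangentBundle {S : AlmostPseudoHermitian I G}
    {T : AlmostPseudoHermitian I.tangent (TangentBundle I G)} (hS : S.IsLeftInvariant)
    (hT : T.IsLeftInvariant) (h : ∀ a : E, T.JOne ((a, 0) : E × E) = (S.JOne a, 0))
    (hTI : T.IsIntegrable) : S.IsIntegrable := by
  intro x
  obtain ⟨m, ψ, hx, hψ, hψs, hJ⟩ := hTI (zeroSec I G x)
  have hz : ContMDiff I I.tangent ∞ (zeroSec I G) := contMDiff_zeroSec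
  let ψ' : G → E × E →L[ℝ] (Fin m → ℂ) := fun y =>
    mfderiv I.tangent 𝓘(ℝ, Fin m → ℂ) ψ (zeroSec I G y)
  have hψd : ∀ y, zeroSec I G y ∈ ψ.source →
      HasMFDerivAt I.tangent 𝓘(ℝ, Fin m → ℂ) ψ (zeroSec I G y) (ψ' y) := fun y hy =>
    ((hψ.contMDiffAt (ψ.open_source.mem_nhds hy)).mdifferentiableAt (by simp)).hasMFDerivAt
  refine S.exists_chart_of_immersion (f := ψ ∘ zeroSec I G) (U := zeroSec I G ⁻¹' ψ.source)
    (ψ.open_source.preimage hz.continuous) (hψ.comp hz.contMDiffOn fun y hy => hy)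
    (fun y => (ψ' y).comp (zeroSecDeriv I G y)) (fun y hy => ?_) (fun y hy v => ?_) hx ?_
  · exact HasMFDerivAt.comp y (hψd y hy) (hz.mdifferentiable (by simp) y).hasMFDerivAt
  · have h1 : zeroSecDeriv I G y (S.J y v) = T.J (zeroSec I G y) (zeroSecDeriv I G y v) := by
      have h2 : mcForm I.tangent (zeroSec I G y) (zeroSecDeriv I G y v) =
          ((mcForm I y v, 0) : E × E) :=
        (congrArg _ (zeroSecDeriv_eq y v)).trans (mcForm_leftMap (E := E × E) _ _)
      refine (zeroSecDeriv_eq (E := E) (I := I) y (S.J y v)).trans (.trans ?_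
        (hT.J_eq (zeroSec I G y) (zeroSecDeriv I G y v)).symm)
      refine congrArg (leftMap I.tangent (zeroSec I G y)) (.trans ?_
        ((h (mcForm I y v)).symm.trans (congrArg T.JOne h2.symm)))
      exact congrArg (fun a : E => ((a, 0) : E × E)) (hS.mcForm_J y v)
    exact (congrArg (ψ' y) h1).trans (hJ _ hy _)
  · have h1 : Function.Injective (ψ' x) := by
      have h2 := ((hψs.contMDiffAt (ψ.open_target.mem_nhds (ψ.map_source hx))).mdifferentiableAt
        (by simp)).hasMFDerivAt.comp _ (hψd x hx)
      have h3 : HasMFDerivAt I.tangent I.tangent (ψ.symm ∘ ψ) (zeroSec I G x)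
          (ContinuousLinearMap.id ℝ (E × E)) :=
        (hasMFDerivAt_id (I := I.tangent) (zeroSec I G x)).congr_of_eventuallyEq (by
          filter_upwards [ψ.open_source.mem_nhds hx] with z hz using ψ.left_inv hz)
      have h4 := h2.mfderiv.symm.trans h3.mfderiv
      exact Function.LeftInverse.injective (g := (mfderiv 𝓘(ℝ, Fin m → ℂ) I.tangent ψ.symm
        (ψ (zeroSec I G x)) : (Fin m → ℂ) →L[ℝ] E × E)) fun v =>
        congrArg (fun A : E × E →L[ℝ] E × E => A v) h4
    refine h1.comp fun v w hvw => ?_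
    have h2 := congrArg (mcForm I.tangent (zeroSec I G x)) ((zeroSecDeriv_eq x v).symm.trans
      (hvw.trans (zeroSecDeriv_eq x w)))
    have h3 := (mcForm_leftMap (E := E × E) (I := I.tangent) (zeroSec I G x)
      (mcForm I x v, 0)).symm.trans (h2.trans (mcForm_leftMap (E := E × E) (I := I.tangent) _ _))
    have h4 := congrArg (fun p : E × E => leftMap I x p.1) h3
    exact (leftMap_mcForm (E := E) (I := I) x v).symm.trans (h4.trans (leftMap_mcForm x w))

end TangentGroup

/-! ### The left-invariant structure on the tangent group -/

section TangentLift

variable {E : Type*} [NormedAddCommGroup E] [NormedSpace ℝ E]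

/-- The bilinear form `((a, b), (a', b')) ↦ B(a, b') + B(b, a')`. -/
def prodMetric (B : E →L[ℝ] E →L[ℝ] ℝ) : E × E →L[ℝ] E × E →L[ℝ] ℝ :=
  B.bilinearComp (.fst ℝ E E) (.snd ℝ E E) + B.bilinearComp (.snd ℝ E E) (.fst ℝ E E)

@[simp]
theorem prodMetric_apply (B : E →L[ℝ] E →L[ℝ] ℝ) (p q : E × E) :
    prodMetric B p q = B p.1 q.2 + B p.2 q.1 := rfl

/-- The bilinear map `((a, b), (a', b')) ↦ (Γ(a, a'), Γ(a, b') + Γ(b, a'))`. -/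
def prodConnection (Γ : E →L[ℝ] E →L[ℝ] E) : E × E →L[ℝ] E × E →L[ℝ] E × E :=
  (ContinuousLinearMap.compL ℝ (E × E) E (E × E) (.inl ℝ E E)).comp
      (Γ.bilinearComp (.fst ℝ E E) (.fst ℝ E E)) +
    (ContinuousLinearMap.compL ℝ (E × E) E (E × E) (.inr ℝ E E)).comp
      (Γ.bilinearComp (.fst ℝ E E) (.snd ℝ E E) + Γ.bilinearComp (.snd ℝ E E) (.fst ℝ E E))

theorem prodConnection_apply (Γ : E →L[ℝ] E →L[ℝ] E) (p q : E × E) :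
    prodConnection Γ p q = (Γ p.1 q.1, Γ p.1 q.2 + Γ p.2 q.1) := by
  change ((Γ p.1 q.1, 0) : E × E) + (0, Γ p.1 q.2 + Γ p.2 q.1) = _
  rw [Prod.mk_add_mk, add_zero, zero_add]

variable [FiniteDimensional ℝ E]
  {H : Type*} [TopologicalSpace H] {I : ModelWithCorners ℝ E H} [I.Boundaryless]
  {G : Type*} [TopologicalSpace G] [ChartedSpace H G] [Group G] [LieGroup I ∞ G]

theorem lieBr_zero_right (a : E) : lieBr I G a 0 = 0 := by
  simpa using lieBr_smul_right (I := I) (G := G) 0 a 0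

theorem lieBr_zero_left (a : E) : lieBr I G 0 a = 0 := by
  rw [lieBr_swap, lieBr_zero_right, neg_zero]

namespace AlmostPseudoHermitian

variable (S : AlmostPseudoHermitian I G)

/-- The left-invariant almost pseudo-Hermitian structure on the tangent group determined by the
value of `S` at the unit. -/
def tangentLift : AlmostPseudoHermitian I.tangent (TangentBundle I G) :=
  ofLeftInvariant (I := I.tangent) (G := TangentBundle I G) (prodMetric S.metricOne)
    (S.JOne.prodMap S.JOne)
    (fun p q => by
      rw [prodMetric_apply, prodMetric_apply, S.metricOne_symm p.1, S.metricOne_symm p.2, add_comm])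
    (fun p h => by
      refine Prod.ext (S.metric_nondegenerate 1 p.1 fun w => ?_)
        (S.metric_nondegenerate 1 p.2 fun w => ?_)
      · have h1 := h (0, w)
        rw [prodMetric_apply, map_zero, add_zero] at h1
        exact h1
      · have h1 := h (w, 0)
        rw [prodMetric_apply, map_zero, zero_add] at h1
        exact h1)
    (fun p => Prod.ext (S.JOne_JOne p.1) (S.JOne_JOne p.2))
    (fun p q => congrArg₂ (· + ·) (S.metricOne_JOne_JOne p.1 q.2) (S.metricOne_JOne_JOne p.2 q.1))

theorem isLeftInvariant_tangentLift : S.tangentLift.IsLeftInvariant :=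
  isLeftInvariant_ofLeftInvariant _ _ _ _

theorem metricOne_tangentLift : S.tangentLift.metricOne = prodMetric S.metricOne :=
  metricOne_ofLeftInvariant _ _ _ _

theorem JOne_tangentLift : S.tangentLift.JOne = S.JOne.prodMap S.JOne :=
  JOne_ofLeftInvariant _ _ _ _

variable {S} in
theorem isTangentLift_iff
    {T : AlmostPseudoHermitian I.tangent (TangentBundle I G)} :
    IsTangentLift S T ↔
      T.metricOne = prodMetric S.metricOne ∧ T.JOne = S.JOne.prodMap S.JOne := by
  have hm : ∀ {p p' q q' : E × E}, p = p' → q = q' → T.metricOne p q = T.metricOne p' q' := by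
    rintro _ _ _ _ rfl rfl; rfl
  constructor
  · intro h
    have hcv : ∀ a b : E, T.metricOne ((a, 0) : E × E) (0, b) = S.metricOne a b := fun a b =>
      (hm (completeLift_eq a).symm (verticalLift_eq b).symm).trans
        (h.metric_complete_vertical a b)
    have hcc : ∀ a b : E, T.metricOne ((a, 0) : E × E) (b, 0) = 0 := fun a b =>
      (hm (completeLift_eq a).symm (completeLift_eq b).symm).trans
        (h.metric_complete_complete a b)
    have hvv : ∀ a b : E, T.metricOne ((0, a) : E × E) (0, b) = 0 := fun a b =>
      (hm (verticalLift_eq a).symm (verticalLift_eq b).symm).trans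
        (h.metric_vertical_vertical a b)
    have hc : ∀ a : E, T.JOne ((a, 0) : E × E) = (S.JOne a, 0) := fun a =>
      (congrArg T.JOne (completeLift_eq a).symm).trans
        ((h.J_complete a).trans (completeLift_eq (S.JOne a)))
    have hv : ∀ a : E, T.JOne ((0, a) : E × E) = (0, S.JOne a) := fun a =>
      (congrArg T.JOne (verticalLift_eq a).symm).trans
        ((h.J_vertical a).trans (verticalLift_eq (S.JOne a)))
    have hp : ∀ p : E × E, p = (p.1, 0) + (0, p.2) := fun p => by simp
    constructor
    · refine ContinuousLinearMap.ext fun p => ContinuousLinearMap.ext fun q => ?_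
      rw [hp p, hp q]
      simp only [map_add, add_apply, hcv, hcc, hvv, T.metricOne_symm (0, p.2) (q.1, 0)]
      simp only [prodMetric_apply, map_zero, zero_apply, S.metricOne_symm q.1]
      ring
    · refine ContinuousLinearMap.ext fun p => ?_
      rw [hp p, map_add, hc, hv, map_add]
      exact congrArg₂ (· + ·) (Prod.ext rfl (map_zero S.JOne).symm)
        (Prod.ext (map_zero S.JOne).symm rfl)
  · rintro ⟨h1, h2⟩
    have hm' : ∀ {p q : E × E} {p' q' : E × E}, p = p' → q = q' →
        T.metricOne p q = S.metricOne p'.1 q'.2 + S.metricOne p'.2 q'.1 := by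
      rintro _ _ _ _ rfl rfl; rw [h1, prodMetric_apply]
    have hcv : ∀ a b : E, T.metricOne (completeLift (I := I) (G := G) a)
        (verticalLift (I := I) (G := G) b) = S.metricOne a b := fun a b => by
      refine (hm' (completeLift_eq a) (verticalLift_eq b)).trans ?_
      rw [map_zero, add_zero]
    have hcc : ∀ a b : E, T.metricOne (completeLift (I := I) (G := G) a)
        (completeLift (I := I) (G := G) b) = 0 := fun a b => by
      refine (hm' (completeLift_eq a) (completeLift_eq b)).trans ?_
      rw [map_zero, map_zero, zero_apply, add_zero]
    have hvv : ∀ a b : E, T.metricOne (verticalLift (I := I) (G := G) a)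
        (verticalLift (I := I) (G := G) b) = 0 := fun a b => by
      refine (hm' (verticalLift_eq a) (verticalLift_eq b)).trans ?_
      rw [map_zero, map_zero, zero_apply, add_zero]
    have hc : ∀ a : E, (T.JOne (completeLift (I := I) (G := G) a) : E × E) =
        completeLift (I := I) (G := G) (S.JOne a) := fun a => by
      refine (congrArg T.JOne (completeLift_eq a)).trans
        (.trans ?_ (completeLift_eq (S.JOne a)).symm)
      rw [h2]
      exact Prod.ext rfl (map_zero S.JOne)
    have hv : ∀ a : E, (T.JOne (verticalLift (I := I) (G := G) a) : E × E) =
        verticalLift (I := I) (G := G) (S.JOne a) := fun a => by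
      refine (congrArg T.JOne (verticalLift_eq a)).trans
        (.trans ?_ (verticalLift_eq (S.JOne a)).symm)
      rw [h2]
      exact Prod.ext (map_zero S.JOne) rfl
    exact ⟨hcv, hcc, hvv, hc, hv⟩

variable {S}

theorem IsNearlyKahlerConnection.tangentLift {Γ : E →L[ℝ] E →L[ℝ] E}
    (hΓ : S.IsNearlyKahlerConnection Γ) :
    S.tangentLift.IsNearlyKahlerConnection (prodConnection Γ) where
  torsion_free := by
    rintro ⟨a, b⟩ ⟨a', b'⟩
    rw [lieBr_tangent, ← hΓ.torsion_free, ← hΓ.torsion_free, ← hΓ.torsion_free,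
      prodConnection_apply, prodConnection_apply]
    refine Prod.ext rfl ?_
    simp only [Prod.snd_sub]
    abel
  metric_compatible := by
    intro p q r
    rw [metricOne_tangentLift]
    simp only [prodMetric_apply, prodConnection_apply, map_add, add_apply]
    linear_combination hΓ.metric_compatible p.1 q.1 r.2 + hΓ.metric_compatible p.1 q.2 r.1 +
      hΓ.metric_compatible p.2 q.1 r.1
  nearly := by
    intro p
    rw [JOne_tangentLift]
    rw [prodConnection_apply, prodConnection_apply]
    refine Prod.ext (hΓ.nearly p.1) ?_
    change Γ p.1 (S.JOne p.2) + Γ p.2 (S.JOne p.1) = S.JOne (Γ p.1 p.2 + Γ p.2 p.1)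
    have h1 := hΓ.nearly (p.1 + p.2)
    simp only [map_add, add_apply, hΓ.nearly p.1, hΓ.nearly p.2] at h1
    simp only [map_add]
    rw [← sub_eq_zero] at h1 ⊢
    rw [← h1]
    abel

theorem nijenhuisOne_tangentLift (a b : E) :
    S.tangentLift.nijenhuisOne ((a, 0) : E × E) (b, 0) = (S.nijenhuisOne a b, 0) := by
  have hJ : ∀ a : E, S.JOne.prodMap S.JOne (a, 0) = (S.JOne a, 0) := fun a =>
    Prod.ext rfl (map_zero S.JOne)
  simp only [nijenhuisOne, JOne_tangentLift, hJ, lieBr_tangent, lieBr_zero_left,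
    lieBr_zero_right, add_zero, Prod.mk_add_mk, Prod.mk_sub_mk, sub_zero]

theorem dOmegaOne_tangentLift (a b c : E) :
    S.tangentLift.dOmegaOne ((a, 0) : E × E) (b, 0) (0, c) = S.dOmegaOne a b c := by
  have h : ∀ p q : E × E, S.tangentLift.omegaOne p q = S.omegaOne p.1 q.2 + S.omegaOne p.2 q.1 := by
    intro p q
    simp only [omegaOne, ContinuousLinearMap.comp_apply, metricOne_tangentLift, JOne_tangentLift]
    rfl
  simp only [dOmegaOne, h, lieBr_tangent, lieBr_zero_left, lieBr_zero_right, map_zero, add_zero,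
    zero_add]

end AlmostPseudoHermitian

end TangentLift

end NearlyKahler

end

theorem theorem1 {E : Type*} [NormedAddCommGroup E] [NormedSpace ℝ E] [FiniteDimensional ℝ E]
    {H : Type*} [TopologicalSpace H] (I : ModelWithCorners ℝ E H) [I.Boundaryless]
    {G : Type*} [TopologicalSpace G] [ChartedSpace H G] [Group G] [LieGroup I ∞ G]
    (S : NearlyKahler.AlmostPseudoHermitian I G) (hS : S.IsLeftInvariant)
    (hNK : S.IsNearlyPseudoKahler) :
    ∃ T : NearlyKahler.AlmostPseudoHermitian I.tangent (TangentBundle I G),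
      T.IsLeftInvariant ∧ NearlyKahler.IsTangentLift S T ∧
      (∀ T' : NearlyKahler.AlmostPseudoHermitian I.tangent (TangentBundle I G),
        T'.IsLeftInvariant → NearlyKahler.IsTangentLift S T' → T' = T) ∧
      T.IsNearlyPseudoKahler ∧
      (¬ S.IsIntegrable → ¬ T.IsIntegrable) ∧
      (¬ S.NijenhuisVanishes → ¬ T.NijenhuisVanishes) ∧
      (S.IsStrictlyNearlyPseudoKahler → T.IsStrictlyNearlyPseudoKahler) := by
  have hT := S.isLeftInvariant_tangentLift
  have hint : S.tangentLift.IsIntegrable → S.IsIntegrable :=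
    NearlyKahler.AlmostPseudoHermitian.IsIntegrable.of_tangentBundle hS hT fun a => by
      rw [S.JOne_tangentLift]
      exact Prod.ext rfl (map_zero S.JOne)
  obtain ⟨Γ, hΓ⟩ := hS.exists_isNearlyKahlerConnection hNK
  have hTNK := hT.isNearlyPseudoKahler hΓ.tangentLift
  refine ⟨S.tangentLift, hT, NearlyKahler.AlmostPseudoHermitian.isTangentLift_iff.2
    ⟨S.metricOne_tangentLift, S.JOne_tangentLift⟩, fun T' hT' h => ?_, hTNK, mt hint, mt fun h => ?_, fun h => ⟨hTNK,
    mt (fun hK => ?_) h.2⟩⟩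
  · obtain ⟨h1, h2⟩ := NearlyKahler.AlmostPseudoHermitian.isTangentLift_iff.1 h
    exact hT'.ext hT (h1.trans S.metricOne_tangentLift.symm) (h2.trans S.JOne_tangentLift.symm)
  · rw [hS.nijenhuisVanishes_iff]
    rw [hT.nijenhuisVanishes_iff] at h
    intro a b
    have h1 := h (a, 0) (b, 0)
    rw [NearlyKahler.AlmostPseudoHermitian.nijenhuisOne_tangentLift] at h1
    exact congrArg Prod.fst h1
  · refine ⟨hint hK.1, hS.dOmega_eq_zero_iff.2 fun a b c => ?_⟩
    rw [← NearlyKahler.AlmostPseudoHermitian.dOmegaOne_tangentLift]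
    exact hT.dOmega_eq_zero_iff.1 hK.2 _ _ _
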